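/- Notation. For a real system $H=(A,B,C)$ with $A\in\mathbb R^{n\times n}$, $B\in\mathbb R^{n\times m}$, $C\in\mathbb R^{p\times n}$ and impulse response $h(\tau)=Ce^{A\tau}B$, and a fixed $t>0$, put $\|H\|_{\mathcal H_{2,t}}=\big(\operatorname{tr}\int_0^t h(\tau)h(\tau)^T\,d\tau\big)^{1/2}$, and define $\|H-\hat H\|_{\mathcal H_{2,t}}$ in the same way from the difference of the impulse responses. Let $P_T=\int_0^t e^{A\tau}BB^Te^{A^T\tau}d\tau$ and $Q_T=\int_0^t e^{A^T\tau}C^TCe^{A\tau}d\tau$; for $\hat H=(\hat A,\hat B,\hat C)$ let $\hat P_T,\hat Q_T$ be its own Gramians over $[0,t]$, and $\tilde P_T=\int_0^t e^{A\tau}B\hat B^Te^{\hat A^T\tau}d\tau$, $\tilde Q_T=\int_0^t e^{\hat A^T\tau}\hat C^TCe^{A\tau}d\tau$. The model $\hat H$ is called time-limited pseudo-optimal with respect to $H$ if $\|H-\hat H\|_{\mathcal H_{2,t}}^2=\|H\|_{\mathcal H_{2,t}}^2-\|\hat H\|_{\mathcal H_{2,t}}^2$. Matrix inequalities below are in the Loewner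 (positive semidefinite) order. V-type construction. Start with empty matrices $S_{tot}^{(0)},L_{tot}^{(0)},V_{tot}^{(0)},P_{tot}^{(0)},\bar B_{tot}^{(0)}$ and $B_\perp^{(0)}=B$. At step $i=1,\dots,k$ choose $r_i$ interpolation points $\sigma_j\in\mathbb C$ with $\operatorname{Re}\sigma_j>0$ that are not eigenvalues of $A$, and tangential directions $c_j\in\mathbb C^m$. Let $V^{(i)}\in\mathbb R^{n\times r_i}$, $S^{(i)}\in\mathbb R^{r_i\times r_i}$, $L^{(i)}\in\mathbb R^{m\times r_i}$ be the matrices of the associated rational Krylov space in a real basis, i.e. for some invertible $T\in\mathbb C^{r_i\times r_i}$, $$V^{(i)}T=\big[(A-\sigma_jI)^{-1}B_\perp^{(i-1)}c_j\big]_j,\qquad S^{(i)}T=T\operatorname{diag}(\sigma_j),\qquad L^{(i)}T=[c_j]_j ,$$ where $(S^{(i)},L^{(i)})$ is observable. Let $Q^{(i)}$ solve $-(S^{(i)})^TQ^{(i)}-Q^{(i)}S^{(i)}+(L^{(i)})^TL^{(i)}=0$ and put (PORK) $\hat B^{(i)}=-(Q^{(i)})^{-1}(L^{(i)})^T$, $B_\perp^{(i)}=B_\perp^{(i-1)}-V^{(i)}\hat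 B^{(i)}$. Accumulate $V_{tot}^{(i)}=[V_{tot}^{(i-1)}\ V^{(i)}]$, $L_{tot}^{(i)}=[L_{tot}^{(i-1)}\ L^{(i)}]$, $$S_{tot}^{(i)}=\begin{bmatrix}S_{tot}^{(i-1)}&-\bar B_{tot}^{(i-1)}L^{(i)}\\0&S^{(i)}\end{bmatrix},\quad \bar B_{tot}^{(i)}=\begin{bmatrix}\bar B_{tot}^{(i-1)}\\\hat B^{(i)}\end{bmatrix},\quad P_{tot}^{(i)}=\begin{bmatrix}P_{tot}^{(i-1)}&0\\0&(Q^{(i)})^{-1}\end{bmatrix}.$$ Put $V_{tot,t}^{(i)}=V_{tot}^{(i)}-e^{At}V_{tot}^{(i)}e^{-S_{tot}^{(i)}t}$, $P_{tot,t}^{(i)}=\big((P_{tot}^{(i)})^{-1}-e^{-(S_{tot}^{(i)})^Tt}(P_{tot}^{(i)})^{-1}e^{-S_{tot}^{(i)}t}\big)^{-1}$, and let $H_{tot}^{(i)}$ be the system $\big(-(S_{tot}^{(i)})^T,\,-(L_{tot}^{(i)})^T,\,CV_{tot,t}^{(i)}P_{tot,t}^{(i)}\big)$, so that $H_{tot}^{(0)}=0$.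 W-type construction (dual). Start with empty matrices and $C_\perp^{(0)}=C$. At step $i$ choose $\sigma_j$ as above and row directions $b_j\in\mathbb C^{1\times p}$. Let $W^{(i)},S^{(i)},L^{(i)}$ be real matrices such that for some invertible $T$, $W^{(i)}T=[(A^T-\sigma_jI)^{-1}(C_\perp^{(i-1)})^Tb_j^T]_j$, $(S^{(i)})^TT=T\operatorname{diag}(\sigma_j)$, $(L^{(i)})^TT=[b_j^T]_j$, with $(S^{(i)},L^{(i)})$ controllable. Let $P^{(i)}$ solve $-S^{(i)}P^{(i)}-P^{(i)}(S^{(i)})^T+L^{(i)}(L^{(i)})^T=0$, and put $\hat C^{(i)}=-(L^{(i)})^T(P^{(i)})^{-1}$, $C_\perp^{(i)}=C_\perp^{(i-1)}-\hat C^{(i)}(W^{(i)})^T$, $W_{tot}^{(i)}=[W_{tot}^{(i-1)}\ W^{(i)}]$, $\bar C_{tot}^{(i)}=[\bar C_{tot}^{(i-1)}\ \hat C^{(i)}]$, $$L_{tot}^{(i)}=\begin{bmatrix}L_{tot}^{(i-1)}\\L^{(i)}\end{bmatrix},\quad S_{tot}^{(i)}=\begin{bmatrix}S_{tot}^{(i-1)}&0\\-L^{(i)}\bar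 C_{tot}^{(i-1)}&S^{(i)}\end{bmatrix},\quad Q_{tot}^{(i)}=\begin{bmatrix}Q_{tot}^{(i-1)}&0\\0&(P^{(i)})^{-1}\end{bmatrix}.$$ Put $W_{tot,t}^{(i)}=W_{tot}^{(i)}-e^{A^Tt}W_{tot}^{(i)}e^{-(S_{tot}^{(i)})^Tt}$, $Q_{tot,t}^{(i)}=\big((Q_{tot}^{(i)})^{-1}-e^{-S_{tot}^{(i)}t}(Q_{tot}^{(i)})^{-1}e^{-(S_{tot}^{(i)})^Tt}\big)^{-1}$, and let $H_{tot}^{(i)}$ be the system $\big(-(S_{tot}^{(i)})^T,\,Q_{tot,t}^{(i)}(W_{tot,t}^{(i)})^TB,\,-(L_{tot}^{(i)})^T\big)$. Claim. For every real system $(A,B,C)$, every $t>0$, every $k$ and every such choice of interpolation data, the V-type construction satisfies: 1. For $0\le i\le k$, all inverses in the construction exist, $H_{tot}^{(i)}$ is time-limited pseudo-optimal with respect to $H$, and it satisfies the optimality condition $\hat C\hat P_T=C\tilde P_T$ (with $\hat H=H_{tot}^{(i)}$). 2. For $1\le i\le k$, $H_{tot}^{(i-1)}$ is time-limited pseudo-optimal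 with respect to $H_{tot}^{(i)}$, and it satisfies the corresponding optimality condition relative to $H_{tot}^{(i)}$. 3. For $1\le i\le k$, $\|H-H_{tot}^{(i)}\|_{\mathcal H_{2,t}}\le\|H-H_{tot}^{(i-1)}\|_{\mathcal H_{2,t}}$. 4. $V_{tot,t}^{(i)}P_{tot,t}^{(i)}(V_{tot,t}^{(i)})^T$ approaches $P_T$ monotonically from below: for $1\le i\le k$, $V_{tot,t}^{(i-1)}P_{tot,t}^{(i-1)}(V_{tot,t}^{(i-1)})^T\preceq V_{tot,t}^{(i)}P_{tot,t}^{(i)}(V_{tot,t}^{(i)})^T$; for $0\le i\le k$, $V_{tot,t}^{(i)}P_{tot,t}^{(i)}(V_{tot,t}^{(i)})^T\preceq P_T$ and $\|H-H_{tot}^{(i)}\|_{\mathcal H_{2,t}}^2=\operatorname{tr}\big(C(P_T-V_{tot,t}^{(i)}P_{tot,t}^{(i)}(V_{tot,t}^{(i)})^T)C^T\big)$. The same four statements hold for the W-type construction, with the optimality condition $\hat Q_T\hat B=\tilde Q_TB$ in place of $\hat C\hat P_T=C\tilde P_T$, with $W_{tot,t}^{(i)}Q_{tot,t}^{(i)}(W_{tot,t}^{(i)})^T$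 and $Q_T$ in place of $V_{tot,t}^{(i)}P_{tot,t}^{(i)}(V_{tot,t}^{(i)})^T$ and $P_T$, and with $\|H-H_{tot}^{(i)}\|_{\mathcal H_{2,t}}^2=\operatorname{tr}\big(B^T(Q_T-W_{tot,t}^{(i)}Q_{tot,t}^{(i)}(W_{tot,t}^{(i)})^T)B\big)$. -/

import Mathlib

open Matrix

noncomputable section

namespace TimeLimited

/-! ## Linear systems, time-limited Gramians and the time-limited norm -/

/-- A real state-space realization `x' = A x + B u`, `y = C x`, with state coordinates indexed by
`ι`, `m` inputs and `p` outputs. -/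
structure StateSpace (ι : Type) (m p : ℕ) where
  A : Matrix ι ι ℝ
  B : Matrix ι (Fin m) ℝ
  C : Matrix (Fin p) ι ℝ

/-- The entrywise integral of a matrix-valued function over `[0, t]`. -/
def matIntegral {α β : Type} (t : ℝ) (F : ℝ → Matrix α β ℝ) : Matrix α β ℝ :=
  Matrix.of fun i j => ∫ τ in (0 : ℝ)..t, F τ i j

section Systems

variable {ι κ : Type} [Fintype ι] [DecidableEq ι] [Fintype κ] [DecidableEq κ] {m p : ℕ}

/-- The impulse response `h(τ) = C exp(A τ) B`. -/
def StateSpace.impulse (G : StateSpace ι m p) (τ : ℝ) : Matrix (Fin p) (Fin m) ℝ :=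
  G.C * NormedSpace.exp (τ • G.A) * G.B

/-- The time-limited norm `√(tr ∫₀ᵗ h hᵀ)` of the system with impulse response `h`. -/
def h2tNorm (t : ℝ) (h : ℝ → Matrix (Fin p) (Fin m) ℝ) : ℝ :=
  Real.sqrt (Matrix.trace (matIntegral t fun τ => h τ * (h τ)ᵀ))

/-- The time-limited norm of a system. -/
def StateSpace.norm2t (t : ℝ) (G : StateSpace ι m p) : ℝ :=
  h2tNorm t G.impulse

/-- The time-limited norm of the error system `G - R`, whose impulse response is the difference
of the two impulse responses. -/
def errNorm2t (t : ℝ) (G : StateSpace ι m p) (R : StateSpace κ m p) : ℝ :=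
  h2tNorm t fun τ => G.impulse τ - R.impulse τ

/-- `R` is a time-limited pseudo-optimal reduced model of `G`:
`‖G - R‖² = ‖G‖² - ‖R‖²` in the time-limited norm. -/
def IsPseudoOptimal (t : ℝ) (G : StateSpace ι m p) (R : StateSpace κ m p) : Prop :=
  errNorm2t t G R ^ 2 = G.norm2t t ^ 2 - R.norm2t t ^ 2

/-- The mixed time-limited controllability Gramian
`∫₀ᵗ exp(A τ) B B̂ᵀ exp(Âᵀ τ) dτ` of `G = (A, B, C)` and `R = (Â, B̂, Ĉ)`. -/
def mixedCtrlGram (t : ℝ) (G : StateSpace ι m p) (R : StateSpace κ m p) : Matrix ι κ ℝ :=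
  matIntegral t fun τ =>
    NormedSpace.exp (τ • G.A) * G.B * R.Bᵀ * NormedSpace.exp (τ • R.Aᵀ)

/-- The time-limited controllability Gramian `∫₀ᵗ exp(A τ) B Bᵀ exp(Aᵀ τ) dτ`. -/
def ctrlGram (t : ℝ) (G : StateSpace ι m p) : Matrix ι ι ℝ :=
  mixedCtrlGram t G G

/-- The mixed time-limited observability Gramian
`∫₀ᵗ exp(Âᵀ τ) Ĉᵀ C exp(A τ) dτ` of `G = (A, B, C)` and `R = (Â, B̂, Ĉ)`. -/
def mixedObsGram (t : ℝ) (G : StateSpace ι m p) (R : StateSpace κ m p) : Matrix κ ι ℝ :=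
  matIntegral t fun τ =>
    NormedSpace.exp (τ • R.Aᵀ) * R.Cᵀ * G.C * NormedSpace.exp (τ • G.A)

/-- The time-limited observability Gramian `∫₀ᵗ exp(Aᵀ τ) Cᵀ C exp(A τ) dτ`. -/
def obsGram (t : ℝ) (G : StateSpace ι m p) : Matrix ι ι ℝ :=
  mixedObsGram t G G

/-- The first-order optimality condition `Ĉ P̂ = C P̃` in terms of controllability Gramians. -/
def CtrlOptimality (t : ℝ) (G : StateSpace ι m p) (R : StateSpace κ m p) : Prop :=
  R.C * ctrlGram t R = G.C * mixedCtrlGram t G R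

/-- The first-order optimality condition `Q̂ B̂ = Q̃ B` in terms of observability Gramians. -/
def ObsOptimality (t : ℝ) (G : StateSpace ι m p) (R : StateSpace κ m p) : Prop :=
  obsGram t R * R.B = mixedObsGram t G R * G.B

/-- Observability of the pair `(S, L)` (Kalman): the common kernel of `L`, `L S`, `L S²`, …
is trivial. -/
def IsObservable (S : Matrix ι ι ℝ) (L : Matrix (Fin m) ι ℝ) : Prop :=
  ∀ x : ι → ℝ, (∀ q : ℕ, (L * S ^ q) *ᵥ x = 0) → x = 0

/-- Controllability of the pair `(S, L)` (Kalman): `L`, `S L`, `S² L`, … have trivial common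
left kernel. -/
def IsControllable (S : Matrix ι ι ℝ) (L : Matrix ι (Fin p) ℝ) : Prop :=
  ∀ x : ι → ℝ, (∀ q : ℕ, x ᵥ* (S ^ q * L) = 0) → x = 0

end Systems

/-- The complexification of a real matrix. -/
def toC {α β : Type} (M : Matrix α β ℝ) : Matrix α β ℂ :=
  M.map Complex.ofReal

/-! ## Rational Krylov data -/

/-- The primitive rational Krylov basis: column `j` is `(A - σⱼ I)⁻¹ B cⱼ`. -/
def krylov {n m r : ℕ} (A : Matrix (Fin n) (Fin n) ℝ) (B : Matrix (Fin n) (Fin m) ℝ)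
    (σ : Fin r → ℂ) (c : Matrix (Fin m) (Fin r) ℂ) : Matrix (Fin n) (Fin r) ℂ :=
  Matrix.of fun i j => ((toC A - σ j • 1)⁻¹ *ᵥ (toC B *ᵥ fun a => c a j)) i

/-- `V`, `S`, `L` are the real matrices of the rational Krylov subspace of `(A, B)` for the
interpolation points `σⱼ` and the tangential directions `cⱼ` (the columns of `c`): for some
invertible change of basis `T`, `V` is the basis of the Krylov space obtained from the primitive
one, `S` represents `diag(σ)` and `L` represents `[c₁ … cᵣ]` in the same basis.
For the primitive basis itself, `T = 1`, one has `S = diag(σ)` and `L = [c₁ … cᵣ]`; a real basis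
is obtained from data closed under complex conjugation. -/
def IsKrylovTriple {n m r : ℕ} (A : Matrix (Fin n) (Fin n) ℝ) (B : Matrix (Fin n) (Fin m) ℝ)
    (σ : Fin r → ℂ) (c : Matrix (Fin m) (Fin r) ℂ) (V : Matrix (Fin n) (Fin r) ℝ)
    (S : Matrix (Fin r) (Fin r) ℝ) (L : Matrix (Fin m) (Fin r) ℝ) : Prop :=
  ∃ T : Matrix (Fin r) (Fin r) ℂ, IsUnit T.det ∧
    toC V * T = krylov A B σ c ∧ toC S * T = T * Matrix.diagonal σ ∧ toC L * T = c

/-! ## V-type cumulative reduction -/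

/-- The matrices of one step of the V-type cumulative reduction. -/
structure VStep (n m : ℕ) where
  r : ℕ
  σ : Fin r → ℂ
  c : Matrix (Fin m) (Fin r) ℂ
  V : Matrix (Fin n) (Fin r) ℝ
  S : Matrix (Fin r) (Fin r) ℝ
  L : Matrix (Fin m) (Fin r) ℝ
  Q : Matrix (Fin r) (Fin r) ℝ

/-- The input matrix `B̂ = -Q⁻¹ Lᵀ` chosen by the pseudo-optimal rational Krylov algorithm. -/
def VStep.Bhat {n m : ℕ} (d : VStep n m) : Matrix (Fin d.r) (Fin m) ℝ :=
  -(d.Q⁻¹ * d.Lᵀ)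

/-- The step is carried out by the pseudo-optimal rational Krylov algorithm for the pair
`(A, B⊥)`. -/
structure VStep.IsPORK {n m : ℕ} (d : VStep n m) (A : Matrix (Fin n) (Fin n) ℝ)
    (Bperp : Matrix (Fin n) (Fin m) ℝ) : Prop where
  re_pos : ∀ j, 0 < (d.σ j).re
  resolvent : ∀ j, IsUnit (toC A - d.σ j • 1).det
  krylov : IsKrylovTriple A Bperp d.σ d.c d.V d.S d.L
  observable : IsObservable d.S d.L
  lyapunov : -(d.Sᵀ * d.Q) - d.Q * d.S + d.Lᵀ * d.L = 0

/-- The matrices accumulated by the V-type cumulative reduction. `Bbar` is the accumulated input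
matrix of the (not time-limited) cumulative reduction. -/
structure VState (n m : ℕ) where
  ι : Type
  [fin : Fintype ι]
  [dec : DecidableEq ι]
  S : Matrix ι ι ℝ
  L : Matrix (Fin m) ι ℝ
  V : Matrix (Fin n) ι ℝ
  P : Matrix ι ι ℝ
  Bbar : Matrix ι (Fin m) ℝ
  Bperp : Matrix (Fin n) (Fin m) ℝ

attribute [instance] VState.fin VState.dec

/-- Before the first step all accumulated matrices are empty and `B⊥ = B`. -/
def VState.start {n m : ℕ} (B : Matrix (Fin n) (Fin m) ℝ) : VState n m where
  ι := Fin 0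
  S := 0
  L := 0
  V := 0
  P := 0
  Bbar := 0
  Bperp := B

/-- Accumulation of one step. -/
def VState.next {n m : ℕ} (s : VState n m) (d : VStep n m) : VState n m where
  ι := s.ι ⊕ Fin d.r
  S := Matrix.fromBlocks s.S (-(s.Bbar * d.L)) 0 d.S
  L := Matrix.fromCols s.L d.L
  V := Matrix.fromCols s.V d.V
  P := Matrix.fromBlocks s.P 0 0 d.Q⁻¹
  Bbar := Matrix.fromRows s.Bbar d.Bhat
  Bperp := s.Bperp - d.V * d.Bhat

/-- The accumulated matrices after `i` steps; step number `i + 1` uses the data `d i`. -/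
def vState {n m : ℕ} (B : Matrix (Fin n) (Fin m) ℝ) (d : ℕ → VStep n m) : ℕ → VState n m
  | 0 => VState.start B
  | i + 1 => (vState B d i).next (d i)

/-- `V_t = V - exp(A t) V exp(-S t)`. -/
def VState.Vt {n m : ℕ} (s : VState n m) (A : Matrix (Fin n) (Fin n) ℝ) (t : ℝ) :
    Matrix (Fin n) s.ι ℝ :=
  s.V - NormedSpace.exp (t • A) * s.V * NormedSpace.exp (t • -s.S)

/-- `P⁻¹ - exp(-Sᵀ t) P⁻¹ exp(-S t)`. -/
def VState.PtInv {n m : ℕ} (s : VState n m) (t : ℝ) : Matrix s.ι s.ι ℝ :=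
  s.P⁻¹ - NormedSpace.exp (t • (-s.S)ᵀ) * s.P⁻¹ * NormedSpace.exp (t • -s.S)

/-- `P_t = (P⁻¹ - exp(-Sᵀ t) P⁻¹ exp(-S t))⁻¹`. -/
def VState.Pt {n m : ℕ} (s : VState n m) (t : ℝ) : Matrix s.ι s.ι ℝ :=
  (s.PtInv t)⁻¹

/-- The accumulated time-limited reduced model `(-Sᵀ, -Lᵀ, C V_t P_t)`. -/
def VState.rom {n m p : ℕ} (s : VState n m) (G : StateSpace (Fin n) m p) (t : ℝ) :
    StateSpace s.ι m p where
  A := (-s.S)ᵀ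
  B := (-s.L)ᵀ
  C := G.C * s.Vt G.A t * s.Pt t

/-- The approximation `V_t P_t V_tᵀ` of the time-limited controllability Gramian. -/
def VState.approxGram {n m : ℕ} (s : VState n m) (A : Matrix (Fin n) (Fin n) ℝ) (t : ℝ) :
    Matrix (Fin n) (Fin n) ℝ :=
  s.Vt A t * s.Pt t * (s.Vt A t)ᵀ

/-! ## W-type cumulative reduction -/

/-- The matrices of one step of the W-type cumulative reduction; the tangential direction of
`σⱼ` is the row `j` of `b`. -/
structure WStep (n p : ℕ) where
  r : ℕ
  σ : Fin r → ℂ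
  b : Matrix (Fin r) (Fin p) ℂ
  W : Matrix (Fin n) (Fin r) ℝ
  S : Matrix (Fin r) (Fin r) ℝ
  L : Matrix (Fin r) (Fin p) ℝ
  P : Matrix (Fin r) (Fin r) ℝ

/-- The output matrix `Ĉ = -Lᵀ P⁻¹`. -/
def WStep.Chat {n p : ℕ} (d : WStep n p) : Matrix (Fin p) (Fin d.r) ℝ :=
  -(d.Lᵀ * d.P⁻¹)

/-- The step is carried out by the output version of the pseudo-optimal rational Krylov algorithm
for the pair `(A, C⊥)`; the Krylov space is that of `(Aᵀ, C⊥ᵀ)`. -/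
structure WStep.IsPORK {n p : ℕ} (d : WStep n p) (A : Matrix (Fin n) (Fin n) ℝ)
    (Cperp : Matrix (Fin p) (Fin n) ℝ) : Prop where
  re_pos : ∀ j, 0 < (d.σ j).re
  resolvent : ∀ j, IsUnit (toC A - d.σ j • 1).det
  krylov : IsKrylovTriple Aᵀ Cperpᵀ d.σ d.bᵀ d.W d.Sᵀ d.Lᵀ
  controllable : IsControllable d.S d.L
  lyapunov : -(d.S * d.P) - d.P * d.Sᵀ + d.L * d.Lᵀ = 0

/-- The matrices accumulated by the W-type cumulative reduction. -/
structure WState (n p : ℕ) where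
  ι : Type
  [fin : Fintype ι]
  [dec : DecidableEq ι]
  S : Matrix ι ι ℝ
  L : Matrix ι (Fin p) ℝ
  W : Matrix (Fin n) ι ℝ
  Q : Matrix ι ι ℝ
  Cbar : Matrix (Fin p) ι ℝ
  Cperp : Matrix (Fin p) (Fin n) ℝ

attribute [instance] WState.fin WState.dec

/-- Before the first step all accumulated matrices are empty and `C⊥ = C`. -/
def WState.start {n p : ℕ} (C : Matrix (Fin p) (Fin n) ℝ) : WState n p where
  ι := Fin 0
  S := 0
  L := 0
  W := 0
  Q := 0
  Cbar := 0
  Cperp := C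

/-- Accumulation of one step. -/
def WState.next {n p : ℕ} (s : WState n p) (d : WStep n p) : WState n p where
  ι := s.ι ⊕ Fin d.r
  S := Matrix.fromBlocks s.S 0 (-(d.L * s.Cbar)) d.S
  L := Matrix.fromRows s.L d.L
  W := Matrix.fromCols s.W d.W
  Q := Matrix.fromBlocks s.Q 0 0 d.P⁻¹
  Cbar := Matrix.fromCols s.Cbar d.Chat
  Cperp := s.Cperp - d.Chat * d.Wᵀ

/-- The accumulated matrices after `i` steps; step number `i + 1` uses the data `d i`. -/
def wState {n p : ℕ} (C : Matrix (Fin p) (Fin n) ℝ) (d : ℕ → WStep n p) : ℕ → WState n p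
  | 0 => WState.start C
  | i + 1 => (wState C d i).next (d i)

/-- `W_t = W - exp(Aᵀ t) W exp(-Sᵀ t)`. -/
def WState.Wt {n p : ℕ} (s : WState n p) (A : Matrix (Fin n) (Fin n) ℝ) (t : ℝ) :
    Matrix (Fin n) s.ι ℝ :=
  s.W - NormedSpace.exp (t • Aᵀ) * s.W * NormedSpace.exp (t • (-s.S)ᵀ)

/-- `Q⁻¹ - exp(-S t) Q⁻¹ exp(-Sᵀ t)`. -/
def WState.QtInv {n p : ℕ} (s : WState n p) (t : ℝ) : Matrix s.ι s.ι ℝ :=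
  s.Q⁻¹ - NormedSpace.exp (t • -s.S) * s.Q⁻¹ * NormedSpace.exp (t • (-s.S)ᵀ)

/-- `Q_t = (Q⁻¹ - exp(-S t) Q⁻¹ exp(-Sᵀ t))⁻¹`. -/
def WState.Qt {n p : ℕ} (s : WState n p) (t : ℝ) : Matrix s.ι s.ι ℝ :=
  (s.QtInv t)⁻¹

/-- The accumulated time-limited reduced model `(-Sᵀ, Q_t W_tᵀ B, -Lᵀ)`. -/
def WState.rom {n m p : ℕ} (s : WState n p) (G : StateSpace (Fin n) m p) (t : ℝ) :
    StateSpace s.ι m p where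
  A := (-s.S)ᵀ
  B := s.Qt t * (s.Wt G.A t)ᵀ * G.B
  C := (-s.L)ᵀ

/-- The approximation `W_t Q_t W_tᵀ` of the time-limited observability Gramian. -/
def WState.approxGram {n p : ℕ} (s : WState n p) (A : Matrix (Fin n) (Fin n) ℝ) (t : ℝ) :
    Matrix (Fin n) (Fin n) ℝ :=
  s.Wt A t * s.Qt t * (s.Wt A t)ᵀ

end TimeLimited

end

/-! The accumulated matrices satisfy two equations at every step: the Sylvester equation `A V - V S
= B L` and the Lyapunov equation `Sᵀ P⁻¹ + P⁻¹ S = Lᵀ L`, with `P` positive definite. Integrating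
the derivative of `exp(A τ) X exp(M τ)` over `[0, t]` turns them into formulas for Gramians: the
mixed Gramian of `G` and the reduced model is `V_t`, and the model's own Gramian is `P_t⁻¹`. The
output matrix `C V_t P_t` therefore satisfies `Ĉ P̂ = C V_t = C P̃`. This makes the cross term of
the squared error equal to `‖Ĥ‖²`, which gives pseudo-optimality and the trace formula. Since `C` is
absent from both equations, it may be replaced by an arbitrary row `xᵀ`; nonnegativity of the
squared error then reads `V_t P_t V_tᵀ ≼ P_T`.

For consecutive models, the inclusion `E` of the old coordinates intertwines the old and new `S`,
`L` and `V`. Hence the old `V_t` is the new one times `E`, and the old `P_t⁻¹` is the compression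
`Eᵀ M E` of the new one `M`. Optimality passes to the pair of models, and monotonicity reduces to `E
(Eᵀ M E)⁻¹ Eᵀ ≼ M⁻¹`.

Invertibility rests on three facts: a Lyapunov solution for an observable pair with spectrum in the
right half-plane is positive definite (`lyapunov_posDef`); conversely, a positive definite solution
with such a spectrum forces observability (`IsAntistable.isObservable`), which covers the
accumulated pair; and the finite-horizon Gramian of an observable pair is positive definite
(`gramian_posDef`). The W-type statements are the V-type ones for the transposed system. -/

namespace TimeLimited

open NormedSpace (exp)

/-! ### Entrywise calculus of matrix exponentials. -/

section Calculus

variable {α β γ δ ι κ : Type}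

/-- Entrywise derivative of a matrix-valued function. -/
def MatHasDerivAt (F : ℝ → Matrix α β ℝ) (F' : Matrix α β ℝ) (x : ℝ) : Prop :=
  ∀ i j, HasDerivAt (fun τ => F τ i j) (F' i j) x

theorem MatHasDerivAt.const (M : Matrix α β ℝ) (x : ℝ) : MatHasDerivAt (fun _ => M) 0 x :=
  fun i j => hasDerivAt_const x (M i j)

theorem MatHasDerivAt.mul [Fintype β] {F : ℝ → Matrix α β ℝ} {F' : Matrix α β ℝ}
    {K : ℝ → Matrix β γ ℝ} {K' : Matrix β γ ℝ} {x : ℝ}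
    (hF : MatHasDerivAt F F' x) (hK : MatHasDerivAt K K' x) :
    MatHasDerivAt (fun τ => F τ * K τ) (F' * K x + F x * K') x := by
  intro i j
  simp only [Matrix.mul_apply, Matrix.add_apply, ← Finset.sum_add_distrib]
  exact HasDerivAt.fun_sum fun l _ => (hF i l).mul (hK l j)

theorem MatHasDerivAt.const_mul [Fintype β] (M : Matrix α β ℝ) {K : ℝ → Matrix β γ ℝ}
    {K' : Matrix β γ ℝ} {x : ℝ} (hK : MatHasDerivAt K K' x) :
    MatHasDerivAt (fun τ => M * K τ) (M * K') x := by
  simpa using (MatHasDerivAt.const M x).mul hK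

theorem MatHasDerivAt.mul_const [Fintype β] {F : ℝ → Matrix α β ℝ} {F' : Matrix α β ℝ} {x : ℝ}
    (hF : MatHasDerivAt F F' x) (M : Matrix β γ ℝ) :
    MatHasDerivAt (fun τ => F τ * M) (F' * M) x := by
  simpa using hF.mul (MatHasDerivAt.const M x)

theorem matHasDerivAt_exp [Fintype ι] [DecidableEq ι] (S : Matrix ι ι ℝ) (x : ℝ) :
    MatHasDerivAt (fun τ => exp (τ • S)) (S * exp (x • S)) x := by
  intro i j
  let _ : NormedRing (Matrix ι ι ℝ) := Matrix.linftyOpNormedRing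
  let _ : NormedAlgebra ℝ (Matrix ι ι ℝ) := Matrix.linftyOpNormedAlgebra
  have h := hasDerivAt_exp_smul_const' (𝕂 := ℝ) S x
  exact (LinearMap.toContinuousLinearMap (Matrix.entryLinearMap ℝ ℝ i j)).hasFDerivAt.comp_hasDerivAt
    x h

theorem exp_smul_mul_self [Fintype ι] [DecidableEq ι] (S : Matrix ι ι ℝ) (x : ℝ) :
    exp (x • S) * S = S * exp (x • S) := by
  let _ : NormedRing (Matrix ι ι ℝ) := Matrix.linftyOpNormedRing
  let _ : NormedAlgebra ℝ (Matrix ι ι ℝ) := Matrix.linftyOpNormedAlgebra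
  exact ((Commute.refl S).smul_left x).exp_left.eq

theorem exp_smul_neg_mul [Fintype ι] [DecidableEq ι] (S : Matrix ι ι ℝ) (x : ℝ) :
    exp (x • S) * exp (x • -S) = 1 := by
  rw [smul_neg, Matrix.exp_neg]
  exact Matrix.mul_nonsing_inv _ ((Matrix.isUnit_iff_isUnit_det _).1 (Matrix.isUnit_exp _))

theorem continuous_exp_smul [Fintype ι] [DecidableEq ι] (S : Matrix ι ι ℝ) :
    Continuous fun τ : ℝ => exp (τ • S) :=
  continuous_matrix fun i j => continuous_iff_continuousAt.2 fun x =>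
    (matHasDerivAt_exp S x i j).continuousAt

theorem matIntegral_of_hasDerivAt {F F' : ℝ → Matrix α β ℝ} (t : ℝ)
    (h : ∀ x, MatHasDerivAt F (F' x) x) (hc : Continuous F') :
    matIntegral t F' = F t - F 0 := by
  ext i j
  exact intervalIntegral.integral_eq_sub_of_hasDerivAt (fun x _ => h x i j)
    ((hc.matrix_elem i j).intervalIntegrable _ _)

theorem matIntegral_sub {F K : ℝ → Matrix α β ℝ} (t : ℝ) (hF : Continuous F) (hK : Continuous K) :
    matIntegral t (fun τ => F τ - K τ) = matIntegral t F - matIntegral t K := by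
  ext i j
  exact intervalIntegral.integral_sub ((hF.matrix_elem i j).intervalIntegrable _ _)
    ((hK.matrix_elem i j).intervalIntegrable _ _)

theorem matIntegral_mul_left [Fintype β] (M : Matrix α β ℝ) {F : ℝ → Matrix β γ ℝ} (t : ℝ)
    (hF : Continuous F) : matIntegral t (fun τ => M * F τ) = M * matIntegral t F := by
  ext i j
  simp only [matIntegral, Matrix.of_apply, Matrix.mul_apply]
  rw [intervalIntegral.integral_finsetSum fun l _ =>
    (((hF.matrix_elem l j).const_mul (M i l)).intervalIntegrable _ _)]
  simp only [intervalIntegral.integral_const_mul]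

theorem matIntegral_mul_right [Fintype β] {F : ℝ → Matrix α β ℝ} (M : Matrix β γ ℝ) (t : ℝ)
    (hF : Continuous F) : matIntegral t (fun τ => F τ * M) = matIntegral t F * M := by
  ext i j
  simp only [matIntegral, Matrix.of_apply, Matrix.mul_apply]
  rw [intervalIntegral.integral_finsetSum fun l _ =>
    (((hF.matrix_elem i l).mul_const (M l j)).intervalIntegrable _ _)]
  simp only [intervalIntegral.integral_mul_const]

theorem matIntegral_transpose (F : ℝ → Matrix α β ℝ) (t : ℝ) :
    (matIntegral t F)ᵀ = matIntegral t fun τ => (F τ)ᵀ :=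
  rfl

theorem trace_matIntegral [Fintype α] {F : ℝ → Matrix α α ℝ} (t : ℝ) (hF : Continuous F) :
    (matIntegral t F).trace = ∫ τ in (0 : ℝ)..t, (F τ).trace := by
  simp only [matIntegral, Matrix.trace, Matrix.diag_apply, Matrix.of_apply]
  rw [intervalIntegral.integral_finsetSum fun l _ => (hF.matrix_elem l l).intervalIntegrable _ _]

/-- The fundamental theorem of calculus for `exp(A τ) X exp(M τ)`. -/
theorem matIntegral_exp_mul_exp [Fintype ι] [DecidableEq ι] [Fintype κ] [DecidableEq κ]
    (A : Matrix ι ι ℝ) (X : Matrix ι κ ℝ) (M : Matrix κ κ ℝ) (t : ℝ) :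
    matIntegral t (fun τ => exp (τ • A) * (A * X + X * M) * exp (τ • M)) =
      exp (t • A) * X * exp (t • M) - X := by
  have hd : ∀ x : ℝ, MatHasDerivAt (fun τ => exp (τ • A) * X * exp (τ • M))
      (exp (x • A) * (A * X + X * M) * exp (x • M)) x := by
    intro x
    have h := ((matHasDerivAt_exp A x).mul_const X).mul (matHasDerivAt_exp M x)
    rw [← exp_smul_mul_self A] at h
    convert h using 1
    simp only [Matrix.mul_add, Matrix.add_mul, Matrix.mul_assoc]
  rw [matIntegral_of_hasDerivAt t hd]
  · simp
  · exact ((continuous_exp_smul A).matrix_mul continuous_const).matrix_mul (continuous_exp_smul M)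

/-- The derivative of `exp(A τ) X exp(-M τ)` vanishes, so this product keeps its initial value `X`.
-/
theorem exp_mul_of_intertwine [Fintype ι] [DecidableEq ι] [Fintype κ] [DecidableEq κ]
    {A : Matrix ι ι ℝ} {X : Matrix ι κ ℝ} {M : Matrix κ κ ℝ} (h : A * X = X * M) (t : ℝ) :
    exp (t • A) * X = X * exp (t • M) := by
  have h1 := matIntegral_exp_mul_exp A X (-M) t
  rw [h, Matrix.mul_neg, add_neg_cancel] at h1
  have h2 : exp (t • A) * X * exp (t • -M) = X := by
    rw [eq_comm, sub_eq_zero.symm, ← neg_eq_zero, neg_sub, ← h1]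
    ext i j
    simp [matIntegral]
  have h3 : exp (t • -M) * exp (t • M) = 1 := by simpa using exp_smul_neg_mul (-M) t
  calc exp (t • A) * X = exp (t • A) * X * (exp (t • -M) * exp (t • M)) := by
        rw [h3, Matrix.mul_one]
    _ = X * exp (t • M) := by rw [← Matrix.mul_assoc, h2]

theorem exp_smul_transpose [Fintype ι] [DecidableEq ι] (S : Matrix ι ι ℝ) (x : ℝ) :
    exp (x • Sᵀ) = (exp (x • S))ᵀ := by
  rw [← Matrix.transpose_smul, Matrix.exp_transpose]

end Calculus

/-! ### Time-limited norms in terms of Gramians. -/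

section Norms

variable {ι κ : Type} [Fintype ι] [DecidableEq ι] [Fintype κ] [DecidableEq κ] {m p : ℕ}

theorem StateSpace.continuous_impulse (G : StateSpace ι m p) : Continuous G.impulse :=
  (continuous_const.matrix_mul (continuous_exp_smul G.A)).matrix_mul continuous_const

theorem mixedCtrlGram_transpose (t : ℝ) (G : StateSpace ι m p) (R : StateSpace κ m p) :
    (mixedCtrlGram t G R)ᵀ = mixedCtrlGram t R G := by
  simp only [mixedCtrlGram, matIntegral_transpose]
  congr 1
  funext τ
  simp [exp_smul_transpose, Matrix.mul_assoc]

theorem matIntegral_impulse_mul (t : ℝ) (G : StateSpace ι m p) (R : StateSpace κ m p) :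
    matIntegral t (fun τ => G.impulse τ * (R.impulse τ)ᵀ) =
      G.C * mixedCtrlGram t G R * R.Cᵀ := by
  have hc : Continuous fun τ : ℝ => exp (τ • G.A) * G.B * R.Bᵀ * exp (τ • R.Aᵀ) :=
    (((continuous_exp_smul _).matrix_mul continuous_const).matrix_mul
      continuous_const).matrix_mul (continuous_exp_smul _)
  rw [mixedCtrlGram, ← matIntegral_mul_left _ _ hc,
    ← matIntegral_mul_right _ _ (continuous_const.matrix_mul hc)]
  congr 1
  funext τ
  simp [StateSpace.impulse, exp_smul_transpose, Matrix.mul_assoc]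

theorem h2tNorm_sq {t : ℝ} (ht : 0 ≤ t) (h : ℝ → Matrix (Fin p) (Fin m) ℝ) :
    h2tNorm t h ^ 2 = (matIntegral t fun τ => h τ * (h τ)ᵀ).trace := by
  refine Real.sq_sqrt (Finset.sum_nonneg fun i _ => ?_)
  refine intervalIntegral.integral_nonneg ht fun τ _ => ?_
  simp only [Matrix.mul_apply, Matrix.transpose_apply]
  exact Finset.sum_nonneg fun j _ => mul_self_nonneg _

theorem norm2t_sq {t : ℝ} (ht : 0 ≤ t) (G : StateSpace ι m p) :
    G.norm2t t ^ 2 = (G.C * ctrlGram t G * G.Cᵀ).trace := by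
  rw [StateSpace.norm2t, h2tNorm_sq ht, matIntegral_impulse_mul, ctrlGram]

theorem errNorm2t_sq {t : ℝ} (ht : 0 ≤ t) (G : StateSpace ι m p) (R : StateSpace κ m p) :
    errNorm2t t G R ^ 2 = (G.C * ctrlGram t G * G.Cᵀ).trace
      - 2 * (G.C * mixedCtrlGram t G R * R.Cᵀ).trace + (R.C * ctrlGram t R * R.Cᵀ).trace := by
  have hG := G.continuous_impulse
  have hR := R.continuous_impulse
  rw [errNorm2t, h2tNorm_sq ht]
  have e : (fun τ => (G.impulse τ - R.impulse τ) * (G.impulse τ - R.impulse τ)ᵀ) = fun τ =>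
      (G.impulse τ * (G.impulse τ)ᵀ - G.impulse τ * (R.impulse τ)ᵀ) -
        (R.impulse τ * (G.impulse τ)ᵀ - R.impulse τ * (R.impulse τ)ᵀ) := by
    funext τ
    simp only [Matrix.transpose_sub, Matrix.sub_mul, Matrix.mul_sub]
    abel
  rw [e, matIntegral_sub, matIntegral_sub, matIntegral_sub]
  · simp only [matIntegral_impulse_mul, Matrix.trace_sub, ctrlGram]
    have : (R.C * mixedCtrlGram t R G * G.Cᵀ).trace = (G.C * mixedCtrlGram t G R * R.Cᵀ).trace := by
      rw [← Matrix.trace_transpose]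
      simp [mixedCtrlGram_transpose, Matrix.mul_assoc]
    rw [this]
    ring
  all_goals first
    | exact hR.matrix_mul hG.matrix_transpose
    | exact hR.matrix_mul hR.matrix_transpose
    | exact hG.matrix_mul hG.matrix_transpose
    | exact hG.matrix_mul hR.matrix_transpose
    | exact (hG.matrix_mul hG.matrix_transpose).sub (hG.matrix_mul hR.matrix_transpose)
    | exact (hR.matrix_mul hG.matrix_transpose).sub (hR.matrix_mul hR.matrix_transpose)

/-- Multiplying the optimality condition by `R.Cᵀ` identifies the cross term with `‖R‖²`. -/
theorem CtrlOptimality.errNorm2t_sq {t : ℝ} (ht : 0 ≤ t) {G : StateSpace ι m p}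
    {R : StateSpace κ m p} (h : CtrlOptimality t G R) :
    errNorm2t t G R ^ 2 =
      (G.C * ctrlGram t G * G.Cᵀ).trace - (R.C * ctrlGram t R * R.Cᵀ).trace := by
  rw [TimeLimited.errNorm2t_sq ht, ← h]
  ring

theorem CtrlOptimality.isPseudoOptimal {t : ℝ} (ht : 0 ≤ t) {G : StateSpace ι m p}
    {R : StateSpace κ m p} (h : CtrlOptimality t G R) : IsPseudoOptimal t G R := by
  rw [IsPseudoOptimal, h.errNorm2t_sq ht, norm2t_sq ht, norm2t_sq ht]

end Norms

/-! ### Real matrices acting on complex vectors. -/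

section Complexification

variable {α β γ : Type}

theorem toC_mul [Fintype β] (M : Matrix α β ℝ) (N : Matrix β γ ℝ) :
    toC (M * N) = toC M * toC N :=
  Matrix.map_mul (f := Complex.ofRealHom)

theorem toC_add (M N : Matrix α β ℝ) : toC (M + N) = toC M + toC N :=
  Matrix.map_add _ Complex.ofReal_add M N

theorem toC_sub (M N : Matrix α β ℝ) : toC (M - N) = toC M - toC N :=
  Matrix.map_sub _ Complex.ofReal_sub M N

theorem toC_conjTranspose (M : Matrix α β ℝ) : (toC M)ᴴ = toC Mᵀ := by
  ext i j
  simp [toC]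

theorem toC_injective : Function.Injective (toC : Matrix α β ℝ → Matrix α β ℂ) :=
  Matrix.map_injective Complex.ofReal_injective

theorem toC_mulVec_ofReal [Fintype β] (M : Matrix α β ℝ) (x : β → ℝ) :
    toC M *ᵥ (fun i => (x i : ℂ)) = fun i => ((M *ᵥ x) i : ℂ) := by
  ext i
  simp [toC, Matrix.mulVec, dotProduct]

theorem re_star_dotProduct_toC_mulVec [Fintype α] (X : Matrix α α ℝ) (v : α → ℂ) :
    (star v ⬝ᵥ toC X *ᵥ v).re =
      (fun i => (v i).re) ⬝ᵥ X *ᵥ (fun i => (v i).re) +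
        (fun i => (v i).im) ⬝ᵥ X *ᵥ (fun i => (v i).im) := by
  simp only [dotProduct, Matrix.mulVec, toC, Matrix.map_apply, Finset.mul_sum, Complex.re_sum,
    ← Finset.sum_add_distrib]
  refine Finset.sum_congr rfl fun i _ => Finset.sum_congr rfl fun j _ => ?_
  simp

theorem re_star_dotProduct_toC_mulVec_pos [Fintype α] {X : Matrix α α ℝ} (hX : X.PosDef)
    {v : α → ℂ} (hv : v ≠ 0) : 0 < (star v ⬝ᵥ toC X *ᵥ v).re := by
  rw [re_star_dotProduct_toC_mulVec]
  have hnn : ∀ x : α → ℝ, 0 ≤ x ⬝ᵥ X *ᵥ x := fun x => by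
    simpa using hX.posSemidef.dotProduct_mulVec_nonneg x
  have hpos : ∀ x : α → ℝ, x ≠ 0 → 0 < x ⬝ᵥ X *ᵥ x := fun x hx => by
    simpa using hX.dotProduct_mulVec_pos hx
  by_cases hre : (fun i => (v i).re) = 0
  · refine add_pos_of_nonneg_of_pos (hnn _) (hpos _ fun him => hv ?_)
    ext i
    exact Complex.ext (congrFun hre i) (congrFun him i)
  · exact add_pos_of_pos_of_nonneg (hpos _ hre) (hnn _)

end Complexification

set_option linter.unusedSectionVars false

/-! ### Lyapunov equations, observability and positive definiteness. -/

section Lyapunov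

variable {ι κ α : Type} [Fintype ι] [DecidableEq ι] [Fintype κ] [DecidableEq κ] [Fintype α] {m : ℕ}

/-- All eigenvalues lie in the open right half-plane. -/
def IsAntistable (S : Matrix ι ι ℝ) : Prop :=
  ∀ (μ : ℂ) (x : ι → ℂ), x ≠ 0 → toC S *ᵥ x = μ • x → 0 < μ.re

theorem isAntistable_of_diagonalization {S : Matrix ι ι ℝ} {T : Matrix ι ι ℂ} {σ : ι → ℂ}
    (hT : IsUnit T.det) (hS : toC S * T = T * Matrix.diagonal σ) (hσ : ∀ j, 0 < (σ j).re) :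
    IsAntistable S := by
  intro μ x hx hμ
  have hy : T *ᵥ (T⁻¹ *ᵥ x) = x := by
    rw [Matrix.mulVec_mulVec, Matrix.mul_nonsing_inv _ hT, Matrix.one_mulVec]
  have hd : Matrix.diagonal σ *ᵥ (T⁻¹ *ᵥ x) = μ • (T⁻¹ *ᵥ x) := by
    have : T⁻¹ * toC S = Matrix.diagonal σ * T⁻¹ := by
      rw [← Matrix.mul_one (T⁻¹ * toC S), ← Matrix.mul_nonsing_inv _ hT]
      rw [show T⁻¹ * toC S * (T * T⁻¹) = T⁻¹ * (toC S * T) * T⁻¹ by simp only [Matrix.mul_assoc], hS,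
        ← Matrix.mul_assoc, Matrix.nonsing_inv_mul _ hT, Matrix.one_mul]
    rw [Matrix.mulVec_mulVec, ← this, ← Matrix.mulVec_mulVec, hμ, Matrix.mulVec_smul]
  have hne : T⁻¹ *ᵥ x ≠ 0 := by
    intro h0
    rw [h0, Matrix.mulVec_zero] at hy
    exact hx hy.symm
  obtain ⟨j, hj⟩ := Function.ne_iff.1 hne
  have := congrFun hd j
  rw [Matrix.mulVec_diagonal, Pi.smul_apply, smul_eq_mul] at this
  rw [← mul_right_cancel₀ hj this]
  exact hσ j

/-- The lower part of an eigenvector is an eigenvector of `S₂` unless it vanishes, and then the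
upper part is one of `S₁`. -/
theorem IsAntistable.fromBlocks {S₁ : Matrix ι ι ℝ} {S₂ : Matrix κ κ ℝ} (h₁ : IsAntistable S₁)
    (h₂ : IsAntistable S₂) (X : Matrix ι κ ℝ) : IsAntistable (Matrix.fromBlocks S₁ X 0 S₂) := by
  intro μ x hx hμ
  have hb : toC (Matrix.fromBlocks S₁ X 0 S₂) =
      Matrix.fromBlocks (toC S₁) (toC X) (toC 0) (toC S₂) := Matrix.fromBlocks_map _ _ _ _ _
  have h0 : toC (0 : Matrix κ ι ℝ) = 0 := by ext; simp [toC]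
  rw [hb, h0, Matrix.fromBlocks_mulVec] at hμ
  have e₁ : toC S₁ *ᵥ (x ∘ Sum.inl) + toC X *ᵥ (x ∘ Sum.inr) = μ • (x ∘ Sum.inl) :=
    funext fun i => congrFun hμ (Sum.inl i)
  have e₂ : toC S₂ *ᵥ (x ∘ Sum.inr) = μ • (x ∘ Sum.inr) := by
    have : (0 : Matrix κ ι ℂ) *ᵥ (x ∘ Sum.inl) + toC S₂ *ᵥ (x ∘ Sum.inr) = μ • (x ∘ Sum.inr) :=
      funext fun i => congrFun hμ (Sum.inr i)
    simpa using this
  by_cases hr : x ∘ Sum.inr = 0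
  · rw [hr, Matrix.mulVec_zero, add_zero] at e₁
    refine h₁ μ _ (fun hl => hx ?_) e₁
    ext (i | i)
    · exact congrFun hl i
    · exact congrFun hr i
  · exact h₂ μ _ hr e₂

/-- Positivity of the Cauchy-like matrices `Kᴴ K ij / (conj σᵢ + σⱼ)`. -/
theorem cauchy_quadraticForm_nonneg {σ : ι → ℂ} (hσ : ∀ j, 0 < (σ j).re) {N : Matrix ι ι ℂ}
    {K : Matrix α ι ℂ} (h : ∀ i j, (star (σ i) + σ j) * N i j = (Kᴴ * K) i j) (a : ι → ℂ) :
    0 ≤ (star a ⬝ᵥ N *ᵥ a).re := by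
  -- The form is followed along `aⱼ exp(-σⱼ τ)`: its real part `f` has derivative `-‖w‖²` and tends
  -- to `0`, so `f 0` is nonnegative.
  let g : ι → ι → ℝ → ℂ := fun i j τ =>
    star (a i) * N i j * a j * Complex.exp (-(star (σ i) + σ j) * τ)
  let f : ℝ → ℝ := fun τ => (∑ i, ∑ j, g i j τ).re
  let w : ℝ → α → ℂ := fun τ l => ∑ j, K l j * a j * Complex.exp (-(σ j) * τ)
  have hg : ∀ i j (τ : ℝ), HasDerivAt (g i j)
      (-(∑ l, star (K l i * a i * Complex.exp (-(σ i) * τ)) *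
        (K l j * a j * Complex.exp (-(σ j) * τ)))) τ := by
    intro i j τ
    have h1 : HasDerivAt (fun τ : ℝ => -(star (σ i) + σ j) * (τ : ℂ)) (-(star (σ i) + σ j)) τ := by
      simpa using (Complex.ofRealCLM.hasDerivAt (x := τ)).const_mul (-(star (σ i) + σ j))
    refine (h1.cexp.const_mul (star (a i) * N i j * a j)).congr_deriv ?_
    have e1 : Complex.exp (-(star (σ i) + σ j) * τ) =
        star (Complex.exp (-(σ i) * τ)) * Complex.exp (-(σ j) * τ) := by
      have : star (Complex.exp (-(σ i) * τ)) = Complex.exp (-(star (σ i)) * τ) := by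
        rw [← starRingEnd_apply, ← Complex.exp_conj]
        simp
      rw [this, ← Complex.exp_add]
      ring_nf
    calc _ = -(star (a i) * a j * Complex.exp (-(star (σ i) + σ j) * τ) *
          ((star (σ i) + σ j) * N i j)) := by ring
      _ = _ := by
        rw [h i j, e1, Matrix.mul_apply, Finset.mul_sum]
        congr 1
        refine Finset.sum_congr rfl fun l _ => ?_
        rw [Matrix.conjTranspose_apply, star_mul', star_mul']
        ring
  have hf : ∀ τ, HasDerivAt f (-(∑ l, Complex.normSq (w τ l))) τ := by
    intro τ
    have h1 := HasDerivAt.fun_sum (u := Finset.univ) fun i _ =>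
      HasDerivAt.fun_sum (u := Finset.univ) fun j _ => hg i j τ
    have h2 := Complex.reCLM.hasFDerivAt.comp_hasDerivAt τ h1
    refine h2.congr_deriv ?_
    have e : (∑ i, ∑ j, -(∑ l, star (K l i * a i * Complex.exp (-(σ i) * τ)) *
        (K l j * a j * Complex.exp (-(σ j) * τ)))) =
        -((∑ l, Complex.normSq (w τ l) : ℝ) : ℂ) := by
      simp only [Finset.sum_neg_distrib, Complex.ofReal_sum, Complex.normSq_eq_conj_mul_self, w,
        starRingEnd_apply, star_sum, Finset.sum_mul_sum]
      rw [Finset.sum_comm (s := (Finset.univ : Finset α))]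
      exact congrArg _ (Finset.sum_congr rfl fun i _ => Finset.sum_comm)
    rw [e]
    simp
  have hanti : Antitone f := by
    refine antitone_of_hasDerivAt_nonpos hf fun τ => ?_
    simpa using Finset.sum_nonneg fun l _ => Complex.normSq_nonneg (w τ l)
  have hlim : Filter.Tendsto f Filter.atTop (nhds 0) := by
    have h1 : Filter.Tendsto (fun τ => ∑ i, ∑ j, g i j τ) Filter.atTop (nhds 0) := by
      rw [show (0 : ℂ) = ∑ i : ι, ∑ j : ι, (0 : ℂ) by simp]
      refine tendsto_finsetSum _ fun i _ => tendsto_finsetSum _ fun j _ => ?_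
      rw [← mul_zero (star (a i) * N i j * a j)]
      refine Filter.Tendsto.const_mul _ ?_
      rw [Complex.tendsto_exp_nhds_zero_iff]
      have : ∀ τ : ℝ, (-(star (σ i) + σ j) * (τ : ℂ)).re = -(((σ i).re + (σ j).re) * τ) := by
        intro τ
        simp
        ring
      simp only [this]
      exact Filter.tendsto_neg_atTop_atBot.comp
        (Filter.tendsto_id.const_mul_atTop (add_pos (hσ i) (hσ j)))
    exact (Complex.continuous_re.tendsto 0).comp h1
  have h0 := hanti.le_of_tendsto hlim 0
  refine h0.trans_eq ?_
  change (∑ i, ∑ j, g i j 0).re = _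
  simp only [g, dotProduct, Matrix.mulVec, Finset.mul_sum, Pi.star_apply]
  congr 1
  refine Finset.sum_congr rfl fun i _ => Finset.sum_congr rfl fun j _ => ?_
  simp
  ring

/-- By the Lyapunov equation the kernel of `Q` lies in that of `L` and is `S`-invariant, so
observability makes it trivial. -/
theorem posDef_of_posSemidef_of_isObservable {S Q : Matrix ι ι ℝ} {L : Matrix (Fin m) ι ℝ}
    (hQ : Q.PosSemidef) (hlyap : Sᵀ * Q + Q * S = Lᵀ * L) (hobs : IsObservable S L) :
    Q.PosDef := by
  have hker : ∀ x : ι → ℝ, Q *ᵥ x = 0 → L *ᵥ x = 0 ∧ Q *ᵥ (S *ᵥ x) = 0 := by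
    intro x hx
    have hsym : Qᵀ = Q := by simpa using hQ.isHermitian.eq
    have h1 : (Lᵀ * L) *ᵥ x = Q *ᵥ (S *ᵥ x) := by
      rw [← hlyap, Matrix.add_mulVec, ← Matrix.mulVec_mulVec, hx, Matrix.mulVec_zero, zero_add,
        Matrix.mulVec_mulVec]
    have h2 : (L *ᵥ x) ⬝ᵥ (L *ᵥ x) = 0 := by
      have : x ⬝ᵥ (Lᵀ * L) *ᵥ x = 0 := by
        rw [h1, Matrix.dotProduct_mulVec, ← Matrix.mulVec_transpose, hsym, hx, zero_dotProduct]
      rwa [← Matrix.mulVec_mulVec, Matrix.dotProduct_mulVec, Matrix.vecMul_transpose] at this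
    have h3 : L *ᵥ x = 0 := dotProduct_self_eq_zero.1 h2
    refine ⟨h3, ?_⟩
    rw [← h1, ← Matrix.mulVec_mulVec, h3, Matrix.mulVec_zero]
  refine Matrix.PosDef.of_dotProduct_mulVec_pos hQ.isHermitian fun x hx => ?_
  refine lt_of_le_of_ne (hQ.dotProduct_mulVec_nonneg x) fun h0 => hx (hobs x fun q => ?_)
  have hQx : Q *ᵥ x = 0 := (hQ.dotProduct_mulVec_zero_iff x).1 h0.symm
  have hpow : ∀ q : ℕ, Q *ᵥ (S ^ q *ᵥ x) = 0 := by
    intro q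
    induction q with
    | zero => simpa using hQx
    | succ q ih =>
      rw [pow_succ', ← Matrix.mulVec_mulVec]
      exact (hker _ ih).2
  rw [← Matrix.mulVec_mulVec]
  exact (hker _ (hpow q)).1

/-- Congruence by `T` diagonalizes the Lyapunov operator: entry `(i, j)` is multiplied by `conj σᵢ +
σⱼ ≠ 0`. Solutions are therefore unique, and `Q` becomes a Cauchy-like matrix. -/
theorem lyapunov_posDef {S Q : Matrix ι ι ℝ} {L : Matrix (Fin m) ι ℝ} {T : Matrix ι ι ℂ}
    {σ : ι → ℂ} (hT : IsUnit T.det) (hS : toC S * T = T * Matrix.diagonal σ)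
    (hσ : ∀ j, 0 < (σ j).re) (hlyap : Sᵀ * Q + Q * S = Lᵀ * L) (hobs : IsObservable S L) :
    Q.PosDef := by
  have hS' : Tᴴ * toC Sᵀ = Matrix.diagonal (star σ) * Tᴴ := by
    rw [← toC_conjTranspose, ← Matrix.conjTranspose_mul, hS, Matrix.conjTranspose_mul,
      Matrix.diagonal_conjTranspose]
  have entry : ∀ (X : Matrix ι ι ℝ) (i j : ι),
      (star (σ i) + σ j) * (Tᴴ * toC X * T) i j = (Tᴴ * toC (Sᵀ * X + X * S) * T) i j := by
    intro X i j
    have : Tᴴ * toC (Sᵀ * X + X * S) * T =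
        Matrix.diagonal (star σ) * (Tᴴ * toC X * T) + Tᴴ * toC X * T * Matrix.diagonal σ := by
      rw [toC_add, toC_mul, toC_mul, Matrix.mul_add, Matrix.add_mul]
      congr 1
      · rw [← Matrix.mul_assoc, hS']
        simp only [Matrix.mul_assoc]
      · simp only [Matrix.mul_assoc, hS]
    rw [this, Matrix.add_apply, Matrix.diagonal_mul, Matrix.mul_diagonal, Pi.star_apply]
    ring
  have hne : ∀ i j, star (σ i) + σ j ≠ 0 := fun i j h0 => by
    have := congrArg Complex.re h0
    simp at this
    linarith [hσ i, hσ j]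
  have hTH : IsUnit (Tᴴ).det := by
    rw [Matrix.det_conjTranspose]
    exact hT.star
  -- Symmetry is not part of the data; it follows because `Qᵀ - Q` solves the homogeneous equation.
  have hsym : Qᵀ = Q := by
    rw [← sub_eq_zero]
    have hz : Sᵀ * (Qᵀ - Q) + (Qᵀ - Q) * S = 0 := by
      have h2 := congrArg Matrix.transpose hlyap
      simp only [Matrix.transpose_add, Matrix.transpose_mul, Matrix.transpose_transpose] at h2
      rw [Matrix.mul_sub, Matrix.sub_mul]
      rw [← sub_eq_zero.2 (h2.trans hlyap.symm)]
      abel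
    have h0 : Tᴴ * toC (Qᵀ - Q) * T = 0 := by
      ext i j
      have h1 := entry (Qᵀ - Q) i j
      rw [hz] at h1
      have h3 : toC (0 : Matrix ι ι ℝ) = 0 := by ext; simp [toC]
      rw [h3] at h1
      exact (mul_eq_zero.1 (h1.trans (by simp))).resolve_left (hne i j)
    apply toC_injective
    have h4 : (Tᴴ)⁻¹ * (Tᴴ * toC (Qᵀ - Q) * T) * T⁻¹ = toC (Qᵀ - Q) := by
      rw [Matrix.mul_assoc Tᴴ, Matrix.nonsing_inv_mul_cancel_left _ _ hTH,
        Matrix.mul_nonsing_inv_cancel_right _ _ hT]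
    rw [← h4, h0]
    ext
    simp [toC]
  refine posDef_of_posSemidef_of_isObservable ?_ hlyap hobs
  refine Matrix.PosSemidef.of_dotProduct_mulVec_nonneg 
    ((Matrix.conjTranspose_eq_transpose_of_trivial Q).trans hsym) fun x => ?_
  let v : ι → ℂ := fun i => (x i : ℂ)
  have hv : T *ᵥ (T⁻¹ *ᵥ v) = v := by
    rw [Matrix.mulVec_mulVec, Matrix.mul_nonsing_inv _ hT, Matrix.one_mulVec]
  have h1 := cauchy_quadraticForm_nonneg hσ (N := Tᴴ * toC Q * T) (K := toC L * T)
    (fun i j => by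
      rw [entry, hlyap, toC_mul, ← toC_conjTranspose, Matrix.conjTranspose_mul]
      simp only [Matrix.mul_assoc]) (T⁻¹ *ᵥ v)
  have h2 : star (T⁻¹ *ᵥ v) ⬝ᵥ (Tᴴ * toC Q * T) *ᵥ (T⁻¹ *ᵥ v) = star v ⬝ᵥ toC Q *ᵥ v := by
    rw [← Matrix.mulVec_mulVec, hv, ← Matrix.mulVec_mulVec, Matrix.dotProduct_mulVec,
      ← Matrix.star_mulVec, hv]
  rw [h2, re_star_dotProduct_toC_mulVec] at h1
  simpa [v, ← Pi.zero_def] using h1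

/-- A nonzero unobservable subspace is invariant, so over `ℂ` it contains an eigenvector `v` of `S`
with `L v = 0`. Evaluating the Lyapunov equation at `v` gives `2 Re μ · v* X v = 0`, although both
factors are positive. -/
theorem IsAntistable.isObservable {S X : Matrix ι ι ℝ} {L : Matrix (Fin m) ι ℝ}
    (hS : IsAntistable S) (hX : X.PosDef) (hlyap : Sᵀ * X + X * S = Lᵀ * L) :
    IsObservable S L := by
  intro x hx
  by_contra hx0
  let N : Submodule ℂ (ι → ℂ) := ⨅ q : ℕ, LinearMap.ker (toC (L * S ^ q)).mulVecLin
  have hN : ∀ v, v ∈ N ↔ ∀ q : ℕ, toC (L * S ^ q) *ᵥ v = 0 := by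
    intro v
    simp [N, Submodule.mem_iInf]
  have hinv : ∀ v ∈ N, (toC S).mulVecLin v ∈ N := by
    intro v hv
    rw [hN] at hv ⊢
    intro q
    rw [Matrix.mulVecLin_apply, Matrix.mulVec_mulVec, ← toC_mul, Matrix.mul_assoc, ← pow_succ]
    exact hv (q + 1)
  have hxN : (fun i => (x i : ℂ)) ∈ N := by
    rw [hN]
    intro q
    rw [toC_mulVec_ofReal, hx q]
    ext
    simp
  have : Nontrivial N := by
    refine ⟨⟨_, hxN⟩, 0, fun h0 => hx0 ?_⟩
    ext i
    have := congrFun (congrArg Subtype.val h0) i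
    simpa using this
  obtain ⟨μ, hμ⟩ := Module.End.exists_eigenvalue ((toC S).mulVecLin.restrict hinv)
  obtain ⟨v, hv⟩ := hμ.exists_hasEigenvector
  have hv0 : (v : ι → ℂ) ≠ 0 := by simpa using hv.2
  have hSv : toC S *ᵥ (v : ι → ℂ) = μ • (v : ι → ℂ) := congrArg Subtype.val hv.apply_eq_smul
  have hLv : toC L *ᵥ (v : ι → ℂ) = 0 := by simpa using (hN _).1 v.2 0
  have hμ0 := hS μ v hv0 hSv
  have hpos := re_star_dotProduct_toC_mulVec_pos hX hv0
  have e1 : star (v : ι → ℂ) ⬝ᵥ toC (Sᵀ * X + X * S) *ᵥ (v : ι → ℂ) =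
      (star μ + μ) * (star (v : ι → ℂ) ⬝ᵥ toC X *ᵥ (v : ι → ℂ)) := by
    rw [toC_add, toC_mul, toC_mul, Matrix.add_mulVec, ← Matrix.mulVec_mulVec,
      ← Matrix.mulVec_mulVec, hSv, dotProduct_add, Matrix.dotProduct_mulVec _ (toC Sᵀ),
      ← toC_conjTranspose, ← Matrix.star_mulVec, hSv, Matrix.mulVec_smul, star_smul,
      smul_dotProduct, dotProduct_smul, smul_eq_mul, smul_eq_mul, add_mul]
  rw [hlyap, toC_mul, ← Matrix.mulVec_mulVec, hLv, Matrix.mulVec_zero, dotProduct_zero] at e1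
  have e2 : star μ + μ = ((2 * μ.re : ℝ) : ℂ) := by
    apply Complex.ext <;> simp
    ring
  rw [e2] at e1
  have e3 := congrArg Complex.re e1
  rw [Complex.re_ofReal_mul, Complex.zero_re] at e3
  nlinarith [mul_pos hμ0 hpos]

/-- If the quadratic form fails to be positive at `x`, then `L exp(S τ) x` vanishes on `[0, t]`;
repeated differentiation makes `exp(S τ) x` unobservable, hence zero. -/
theorem gramian_posDef {S : Matrix ι ι ℝ} {L : Matrix (Fin m) ι ℝ} (hobs : IsObservable S L)
    {t : ℝ} (ht : 0 < t) :
    (matIntegral t fun τ => exp (τ • Sᵀ) * Lᵀ * L * exp (τ • S)).PosDef := by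
  have hc : Continuous fun τ : ℝ => exp (τ • Sᵀ) * Lᵀ * L * exp (τ • S) :=
    (((continuous_exp_smul _).matrix_mul continuous_const).matrix_mul
      continuous_const).matrix_mul (continuous_exp_smul _)
  refine Matrix.PosDef.of_dotProduct_mulVec_pos ?_ fun x hx => ?_
  · rw [Matrix.IsHermitian, Matrix.conjTranspose_eq_transpose_of_trivial, matIntegral_transpose]
    congr 1
    funext τ
    simp [exp_smul_transpose, Matrix.mul_assoc]
  -- As a one-column matrix, `x` falls under the matrix rules for derivatives and integrals.
  let X : Matrix ι Unit ℝ := Matrix.replicateCol Unit x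
  have hf : ∀ τ : ℝ, (Xᵀ * (exp (τ • Sᵀ) * Lᵀ * L * exp (τ • S)) * X).trace =
      ∑ i, ((L * exp (τ • S) * X) i ()) ^ 2 := by
    intro τ
    have : Xᵀ * (exp (τ • Sᵀ) * Lᵀ * L * exp (τ • S)) * X =
        (L * exp (τ • S) * X)ᵀ * (L * exp (τ • S) * X) := by
      simp [exp_smul_transpose, Matrix.mul_assoc]
    rw [this]
    simp only [Matrix.trace, Finset.univ_unique, Matrix.diag_apply, Finset.sum_singleton, sq]
    rfl
  have hint : star x ⬝ᵥ (matIntegral t fun τ => exp (τ • Sᵀ) * Lᵀ * L * exp (τ • S)) *ᵥ x =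
      ∫ τ in (0 : ℝ)..t, ∑ i, ((L * exp (τ • S) * X) i ()) ^ 2 := by
    simp only [← hf]
    rw [← trace_matIntegral _ ((continuous_const.matrix_mul hc).matrix_mul continuous_const),
      matIntegral_mul_right _ _ (continuous_const.matrix_mul hc), matIntegral_mul_left _ _ hc]
    simp only [Matrix.trace, Finset.univ_unique, Matrix.diag_apply, Finset.sum_singleton,
      Matrix.mul_assoc, X, star_trivial]
    rfl
  have hcf : Continuous fun τ : ℝ => ∑ i, ((L * exp (τ • S) * X) i ()) ^ 2 :=
    continuous_finsetSum _ fun i _ => ((((continuous_const.matrix_mul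
      (continuous_exp_smul S)).matrix_mul continuous_const).matrix_elem i ()).pow 2)
  rw [hint]
  refine intervalIntegral.integral_pos ht hcf.continuousOn
    (fun τ _ => Finset.sum_nonneg fun i _ => sq_nonneg _) ?_
  by_contra! hno
  have hzero : ∀ q : ℕ, ∀ τ ∈ Set.Ioo 0 t, L * S ^ q * exp (τ • S) * X = 0 := by
    intro q
    induction q with
    | zero =>
      intro τ hτ
      have h0 := hno τ ⟨hτ.1.le, hτ.2.le⟩
      have h1 := (Finset.sum_eq_zero_iff_of_nonneg fun i _ => sq_nonneg _).1
        (le_antisymm h0 (Finset.sum_nonneg fun i _ => sq_nonneg ((L * exp (τ • S) * X) i ())))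
      ext i j
      simpa using h1 i (Finset.mem_univ i)
    | succ q ih =>
      intro τ hτ
      have hd := ((matHasDerivAt_exp S τ).const_mul (L * S ^ q)).mul_const X
      ext i j
      have h1 : HasDerivAt (fun τ : ℝ => (L * S ^ q * exp (τ • S) * X) i j) 0 τ := by
        refine (hasDerivAt_const τ (0 : ℝ)).congr_of_eventuallyEq ?_
        filter_upwards [Ioo_mem_nhds hτ.1 hτ.2] with s hs
        rw [ih s hs, Matrix.zero_apply]
      have h2 := (hd i j).unique h1
      rw [Matrix.zero_apply, ← h2, pow_succ]
      simp only [Matrix.mul_assoc]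
  -- Any interior point would do; differentiation is available only inside the interval.
  have hhalf := fun q => hzero q (t / 2) ⟨by linarith, by linarith⟩
  have hy : exp ((t / 2) • S) *ᵥ x = 0 := by
    refine hobs _ fun q => ?_
    ext i
    have := congrFun (congrFun (hhalf q) i) ()
    rw [Matrix.mulVec_mulVec]
    exact this
  refine hx ?_
  have h1 := exp_smul_neg_mul (-S) (t / 2)
  rw [neg_neg] at h1
  rw [← Matrix.one_mulVec x, ← h1, ← Matrix.mulVec_mulVec, hy, Matrix.mulVec_zero]

end Lyapunov

/-! ### The V-type reduction: invariants and Gramians. -/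

section VType

variable {n m p : ℕ}

theorem mul_krylov {r : ℕ} {A : Matrix (Fin n) (Fin n) ℝ} {B : Matrix (Fin n) (Fin m) ℝ}
    {σ : Fin r → ℂ} (c : Matrix (Fin m) (Fin r) ℂ)
    (hσ : ∀ j, IsUnit (toC A - σ j • 1).det) :
    toC A * krylov A B σ c = krylov A B σ c * Matrix.diagonal σ + toC B * c := by
  ext i j
  have h1 : (toC A - σ j • 1) *ᵥ ((toC A - σ j • 1)⁻¹ *ᵥ (toC B *ᵥ fun a => c a j)) =
      toC B *ᵥ fun a => c a j := by
    rw [Matrix.mulVec_mulVec, Matrix.mul_nonsing_inv _ (hσ j), Matrix.one_mulVec]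
  rw [Matrix.sub_mulVec, Matrix.smul_mulVec, Matrix.one_mulVec, sub_eq_iff_eq_add'] at h1
  rw [Matrix.add_apply, Matrix.mul_diagonal, mul_comm]
  exact congrFun h1 i

/-- The equation holds column by column in the primitive basis, and the invertible `T` cancels. -/
theorem IsKrylovTriple.sylvester {r : ℕ} {A : Matrix (Fin n) (Fin n) ℝ}
    {B : Matrix (Fin n) (Fin m) ℝ} {σ : Fin r → ℂ} {c : Matrix (Fin m) (Fin r) ℂ}
    {V : Matrix (Fin n) (Fin r) ℝ} {S : Matrix (Fin r) (Fin r) ℝ} {L : Matrix (Fin m) (Fin r) ℝ}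
    (h : IsKrylovTriple A B σ c V S L) (hσ : ∀ j, IsUnit (toC A - σ j • 1).det) :
    A * V - V * S = B * L := by
  obtain ⟨T, hT, hV, hS, hL⟩ := h
  apply toC_injective
  have h1 : toC (A * V - V * S) * T = toC (B * L) * T := by
    rw [toC_sub, toC_mul, toC_mul, toC_mul, Matrix.sub_mul, Matrix.mul_assoc, hV,
      Matrix.mul_assoc (toC V), hS, ← Matrix.mul_assoc (toC V), hV, Matrix.mul_assoc (toC B), hL,
      mul_krylov c hσ, add_sub_cancel_left]
  rw [← Matrix.mul_nonsing_inv_cancel_right T (toC (A * V - V * S)) hT, h1,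
    Matrix.mul_nonsing_inv_cancel_right _ _ hT]

theorem VStep.IsPORK.posDef {d : VStep n m} {A : Matrix (Fin n) (Fin n) ℝ}
    {B : Matrix (Fin n) (Fin m) ℝ} (h : d.IsPORK A B) : d.Q.PosDef := by
  obtain ⟨T, hT, -, hS, -⟩ := h.krylov
  refine lyapunov_posDef hT hS h.re_pos ?_ h.observable
  rw [← sub_eq_zero, ← neg_eq_zero, ← h.lyapunov]
  abel

theorem VStep.IsPORK.isAntistable {d : VStep n m} {A : Matrix (Fin n) (Fin n) ℝ}
    {B : Matrix (Fin n) (Fin m) ℝ} (h : d.IsPORK A B) : IsAntistable d.S := by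
  obtain ⟨T, hT, -, hS, -⟩ := h.krylov
  exact isAntistable_of_diagonalization hT hS h.re_pos

/-- The invariants of the V-type cumulative reduction of `(A, B)`. -/
structure VState.IsCumulative (s : VState n m) (A : Matrix (Fin n) (Fin n) ℝ)
    (B : Matrix (Fin n) (Fin m) ℝ) : Prop where
  sylvester : A * s.V - s.V * s.S = B * s.L
  bbar : s.Bbar = -(s.P * s.Lᵀ)
  bperp : s.Bperp = B - s.V * s.Bbar
  posDef : s.P.PosDef
  lyapunov : s.Sᵀ * s.P⁻¹ + s.P⁻¹ * s.S = s.Lᵀ * s.L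
  antistable : IsAntistable s.S

theorem VState.isCumulative_start (A : Matrix (Fin n) (Fin n) ℝ) (B : Matrix (Fin n) (Fin m) ℝ) :
    (VState.start B).IsCumulative A B where
  sylvester := by ext i j; exact j.elim0
  bbar := by ext i j; exact i.elim0
  bperp := (by simp : B = B - (0 : Matrix (Fin n) (Fin 0) ℝ) * (0 : Matrix (Fin 0) (Fin m) ℝ))
  posDef := Matrix.PosDef.of_dotProduct_mulVec_pos (by ext i; exact i.elim0)
    fun x hx => absurd (funext fun i => i.elim0) hx
  lyapunov := by ext i j; exact j.elim0
  antistable := fun _ x hx => absurd (funext fun i => i.elim0) hx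

theorem isUnit_det_of_posDef {ι : Type} [Fintype ι] [DecidableEq ι] {M : Matrix ι ι ℝ}
    (h : M.PosDef) : IsUnit M.det :=
  h.det_pos.ne'.isUnit

theorem posDef_fromBlocks_diagonal {ι κ : Type} [Fintype ι] [Fintype κ] {M : Matrix ι ι ℝ}
    {N : Matrix κ κ ℝ} (hM : M.PosDef) (hN : N.PosDef) : (Matrix.fromBlocks M 0 0 N).PosDef := by
  refine Matrix.PosDef.of_dotProduct_mulVec_pos
    (hM.isHermitian.fromBlocks (by simp) hN.isHermitian) fun x hx => ?_
  have e : star x ⬝ᵥ Matrix.fromBlocks M 0 0 N *ᵥ x =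
      (x ∘ Sum.inl) ⬝ᵥ M *ᵥ (x ∘ Sum.inl) + (x ∘ Sum.inr) ⬝ᵥ N *ᵥ (x ∘ Sum.inr) := by
    rw [Matrix.fromBlocks_mulVec]
    simp [dotProduct]
  rw [e]
  have hM0 := hM.posSemidef.dotProduct_mulVec_nonneg (x ∘ Sum.inl)
  have hN0 := hN.posSemidef.dotProduct_mulVec_nonneg (x ∘ Sum.inr)
  by_cases hl : x ∘ Sum.inl = 0
  · refine add_pos_of_nonneg_of_pos hM0 (hN.dotProduct_mulVec_pos fun hr => hx ?_)
    ext (i | i)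
    · exact congrFun hl i
    · exact congrFun hr i
  · exact add_pos_of_pos_of_nonneg (hM.dotProduct_mulVec_pos hl) hN0

theorem inv_fromBlocks_diagonal {ι κ : Type} [Fintype ι] [Fintype κ] [DecidableEq ι]
    [DecidableEq κ] {M : Matrix ι ι ℝ} {N : Matrix κ κ ℝ} (hM : IsUnit M.det) (hN : IsUnit N.det) :
    (Matrix.fromBlocks M 0 0 N)⁻¹ = Matrix.fromBlocks M⁻¹ 0 0 N⁻¹ := by
  apply Matrix.inv_eq_right_inv
  simp [Matrix.fromBlocks_multiply, Matrix.mul_nonsing_inv _ hM, Matrix.mul_nonsing_inv _ hN]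

/-- The off-diagonal block `-B̄ L` of the new `S` serves both equations. As `B⊥ = B - V B̄`, it
converts the Sylvester equation for `B⊥` into one for `B`; as `P⁻¹ B̄ = -Lᵀ`, it produces the mixed
blocks of `Lᵀ L`, so `P` can stay block diagonal. -/
theorem VState.IsCumulative.next {s : VState n m} {A : Matrix (Fin n) (Fin n) ℝ}
    {B : Matrix (Fin n) (Fin m) ℝ} (hs : s.IsCumulative A B) {d : VStep n m}
    (hd : d.IsPORK A s.Bperp) : (s.next d).IsCumulative A B := by
  have hQ := hd.posDef
  have hsym : (s.P⁻¹)ᵀ = s.P⁻¹ := by simpa using hs.posDef.isHermitian.inv.eq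
  have hPu := isUnit_det_of_posDef hs.posDef
  have hbb : s.P⁻¹ * s.Bbar = -s.Lᵀ := by
    rw [hs.bbar, Matrix.mul_neg, Matrix.nonsing_inv_mul_cancel_left _ _ hPu]
  have hQi : IsUnit d.Q⁻¹.det := isUnit_det_of_posDef hQ.inv
  have hinv : (s.next d).P⁻¹ = Matrix.fromBlocks s.P⁻¹ 0 0 d.Q := by
    change (Matrix.fromBlocks s.P 0 0 d.Q⁻¹)⁻¹ = _
    rw [inv_fromBlocks_diagonal hPu hQi, Matrix.nonsing_inv_nonsing_inv _ (isUnit_det_of_posDef hQ)]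
  refine ⟨?_, ?_, ?_, ?_, ?_, hs.antistable.fromBlocks hd.isAntistable _⟩
  · have h1 := hd.krylov.sylvester hd.resolvent
    change A * Matrix.fromCols s.V d.V -
      Matrix.fromCols s.V d.V * Matrix.fromBlocks s.S (-(s.Bbar * d.L)) 0 d.S =
        B * Matrix.fromCols s.L d.L
    have h2 : A * d.V - (s.V * -(s.Bbar * d.L) + d.V * d.S) = B * d.L := by
      rw [Matrix.mul_neg, neg_add_eq_sub, sub_sub_eq_add_sub, add_sub_right_comm, h1, hs.bperp,
        Matrix.sub_mul, Matrix.mul_assoc, sub_add_cancel]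
    rw [Matrix.mul_fromCols, Matrix.mul_fromCols, Matrix.fromCols_mul_fromBlocks, Matrix.mul_zero,
      add_zero, ← h2, ← hs.sylvester]
    ext i (j | j) <;> rfl
  · change Matrix.fromRows s.Bbar d.Bhat =
      -(Matrix.fromBlocks s.P 0 0 d.Q⁻¹ * (Matrix.fromCols s.L d.L)ᵀ)
    rw [Matrix.transpose_fromCols, Matrix.fromBlocks_mul_fromRows, hs.bbar]
    ext (i | i) j <;> simp [VStep.Bhat]
  · change s.Bperp - d.V * d.Bhat =
      B - Matrix.fromCols s.V d.V * Matrix.fromRows s.Bbar d.Bhat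
    rw [Matrix.fromCols_mul_fromRows, hs.bperp, sub_sub]
  · exact posDef_fromBlocks_diagonal hs.posDef hQ.inv
  · have h1 : d.Sᵀ * d.Q + d.Q * d.S = d.Lᵀ * d.L := by
      rw [← sub_eq_zero, ← neg_eq_zero, ← hd.lyapunov]
      abel
    have h2 : s.P⁻¹ * -(s.Bbar * d.L) = s.Lᵀ * d.L := by
      rw [Matrix.mul_neg, ← Matrix.mul_assoc, hbb, Matrix.neg_mul, neg_neg]
    have h3 : (-(s.Bbar * d.L))ᵀ * s.P⁻¹ = d.Lᵀ * s.L := by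
      rw [← Matrix.transpose_inj]
      simpa [hsym] using h2
    have key : (Matrix.fromBlocks s.S (-(s.Bbar * d.L)) 0 d.S)ᵀ *
          Matrix.fromBlocks s.P⁻¹ 0 0 d.Q +
        Matrix.fromBlocks s.P⁻¹ 0 0 d.Q * Matrix.fromBlocks s.S (-(s.Bbar * d.L)) 0 d.S =
          (Matrix.fromCols s.L d.L)ᵀ * Matrix.fromCols s.L d.L := by
      rw [Matrix.fromBlocks_transpose, Matrix.fromBlocks_multiply, Matrix.fromBlocks_multiply,
        Matrix.fromBlocks_add, Matrix.transpose_fromCols, Matrix.fromRows_mul_fromCols, h2, h3,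
        ← h1, ← hs.lyapunov]
      simp
    rw [hinv]
    exact key

theorem isCumulative_vState {A : Matrix (Fin n) (Fin n) ℝ} {B : Matrix (Fin n) (Fin m) ℝ}
    {d : ℕ → VStep n m} {k : ℕ} (h : ∀ i < k, (d i).IsPORK A (vState B d i).Bperp) :
    ∀ i ≤ k, (vState B d i).IsCumulative A B
  | 0, _ => VState.isCumulative_start A B
  | i + 1, hi => (isCumulative_vState h i (Nat.le_of_succ_le hi)).next (h i hi)

variable {s : VState n m} {G : StateSpace (Fin n) m p}

/-- With `X = -V` and `M = -S`, the Sylvester equation makes the integrand of the mixed Gramian an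
exact derivative. -/
theorem VState.IsCumulative.mixedCtrlGram_rom (hs : s.IsCumulative G.A G.B) (t : ℝ) :
    mixedCtrlGram t G (s.rom G t) = s.Vt G.A t := by
  have h := matIntegral_exp_mul_exp G.A (-s.V) (-s.S) t
  have e : G.A * -s.V + -s.V * -s.S = -(G.B * s.L) := by
    rw [← hs.sylvester, Matrix.neg_mul, Matrix.mul_neg, Matrix.mul_neg]
    abel
  rw [e] at h
  rw [VState.Vt, mixedCtrlGram]
  refine Eq.trans ?_ (h.trans ?_)
  · congr 1
    funext τ
    simp [VState.rom, Matrix.mul_assoc]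
  · rw [Matrix.mul_neg, Matrix.neg_mul]
    abel

/-- The same integration with `X = -P⁻¹`, using the Lyapunov equation. -/
theorem VState.IsCumulative.ctrlGram_rom (hs : s.IsCumulative G.A G.B) (t : ℝ) :
    ctrlGram t (s.rom G t) = s.PtInv t := by
  have h := matIntegral_exp_mul_exp (-s.S)ᵀ (-s.P⁻¹) (-s.S) t
  have e : (-s.S)ᵀ * -s.P⁻¹ + -s.P⁻¹ * -s.S = s.Lᵀ * s.L := by
    rw [← hs.lyapunov, Matrix.transpose_neg, neg_mul_neg, neg_mul_neg]
  rw [e] at h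
  rw [VState.PtInv, ctrlGram, mixedCtrlGram]
  refine Eq.trans ?_ (h.trans ?_)
  · congr 1
    funext τ
    simp [VState.rom, Matrix.mul_assoc]
  · rw [Matrix.mul_neg, Matrix.neg_mul]
    abel

theorem VState.IsCumulative.PtInv_posDef {A : Matrix (Fin n) (Fin n) ℝ}
    {B : Matrix (Fin n) (Fin m) ℝ} (hs : s.IsCumulative A B) {t : ℝ} (ht : 0 < t) :
    (s.PtInv t).PosDef := by
  have hobs := hs.antistable.isObservable hs.posDef.inv hs.lyapunov
  -- Replacing `S` by `-S` changes only the signs of the `L S ^ q`.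
  have hobs' : IsObservable (-s.S) s.L := fun x hx => hobs x fun q => by
    rcases Nat.even_or_odd q with h | h
    · simpa [h.neg_pow] using hx q
    · simpa [h.neg_pow, Matrix.neg_mulVec] using hx q
  have h := gramian_posDef hobs' ht
  -- The Gramian does not involve the output matrix, so an empty one suffices.
  rw [← VState.IsCumulative.ctrlGram_rom (G := ⟨A, B, (0 : Matrix (Fin 0) _ ℝ)⟩) hs t]
  convert h using 1
  rw [ctrlGram, mixedCtrlGram]
  congr 1
  funext τ
  simp [VState.rom, Matrix.mul_assoc]

theorem VState.IsCumulative.isUnit_det_PtInv {A : Matrix (Fin n) (Fin n) ℝ}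
    {B : Matrix (Fin n) (Fin m) ℝ} (hs : s.IsCumulative A B) {t : ℝ} (ht : 0 < t) :
    IsUnit (s.PtInv t).det :=
  isUnit_det_of_posDef (hs.PtInv_posDef ht)

theorem VState.IsCumulative.Pt_transpose {A : Matrix (Fin n) (Fin n) ℝ}
    {B : Matrix (Fin n) (Fin m) ℝ} (hs : s.IsCumulative A B) {t : ℝ} (ht : 0 < t) :
    (s.Pt t)ᵀ = s.Pt t := by
  have h := (hs.PtInv_posDef ht).isHermitian.inv.eq
  rwa [Matrix.conjTranspose_eq_transpose_of_trivial] at h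

theorem VState.IsCumulative.approxGram_transpose {A : Matrix (Fin n) (Fin n) ℝ}
    {B : Matrix (Fin n) (Fin m) ℝ} (hs : s.IsCumulative A B) {t : ℝ} (ht : 0 < t) :
    (s.approxGram A t)ᵀ = s.approxGram A t := by
  simp [VState.approxGram, hs.Pt_transpose ht, Matrix.mul_assoc]

theorem VState.IsCumulative.ctrlOptimality (hs : s.IsCumulative G.A G.B) {t : ℝ} (ht : 0 < t) :
    CtrlOptimality t G (s.rom G t) := by
  rw [CtrlOptimality, hs.ctrlGram_rom, hs.mixedCtrlGram_rom]
  exact Matrix.nonsing_inv_mul_cancel_right _ _ (hs.isUnit_det_PtInv ht)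

theorem VState.IsCumulative.errNorm2t_sq (hs : s.IsCumulative G.A G.B) {t : ℝ} (ht : 0 < t) :
    errNorm2t t G (s.rom G t) ^ 2 =
      (G.C * (ctrlGram t G - s.approxGram G.A t) * G.Cᵀ).trace := by
  rw [(hs.ctrlOptimality ht).errNorm2t_sq ht.le, hs.ctrlOptimality ht, hs.mixedCtrlGram_rom,
    Matrix.mul_sub, Matrix.sub_mul, Matrix.trace_sub]
  simp [VState.rom, VState.approxGram, hs.Pt_transpose ht, Matrix.mul_assoc]

theorem VState.IsCumulative.posSemidef_ctrlGram_sub (hs : s.IsCumulative G.A G.B) {t : ℝ}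
    (ht : 0 < t) : (ctrlGram t G - s.approxGram G.A t).PosSemidef := by
  refine Matrix.PosSemidef.of_dotProduct_mulVec_nonneg ?_ fun x => ?_
  · rw [Matrix.IsHermitian, Matrix.conjTranspose_eq_transpose_of_trivial, Matrix.transpose_sub,
      hs.approxGram_transpose ht, ctrlGram, mixedCtrlGram_transpose]
  -- With the single row `x` as output matrix, the squared error is the quadratic form at `x`.
  · have h := VState.IsCumulative.errNorm2t_sq
      (G := ⟨G.A, G.B, Matrix.replicateRow (Fin 1) x⟩) hs ht
    have h0 := h ▸ sq_nonneg _
    refine h0.trans_eq ?_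
    simp only [Matrix.trace, Finset.univ_unique, Matrix.diag_apply, Finset.sum_singleton,
      Matrix.mul_assoc]
    rfl

/-- The inclusion of the old state coordinates into the new ones. -/
def VState.incl (s : VState n m) (d : VStep n m) : Matrix (s.next d).ι s.ι ℝ :=
  (Matrix.fromRows 1 0 : Matrix (s.ι ⊕ Fin d.r) s.ι ℝ)

theorem VState.S_next_mul_incl (s : VState n m) (d : VStep n m) :
    (s.next d).S * s.incl d = s.incl d * s.S := by
  have h : Matrix.fromBlocks s.S (-(s.Bbar * d.L)) 0 d.S *
      (Matrix.fromRows 1 0 : Matrix (s.ι ⊕ Fin d.r) s.ι ℝ) =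
        (Matrix.fromRows 1 0 : Matrix (s.ι ⊕ Fin d.r) s.ι ℝ) * s.S := by
    rw [Matrix.fromBlocks_mul_fromRows, Matrix.fromRows_mul]
    simp
  exact h

theorem VState.V_next_mul_incl (s : VState n m) (d : VStep n m) :
    (s.next d).V * s.incl d = s.V := by
  have h : Matrix.fromCols s.V d.V * (Matrix.fromRows 1 0 : Matrix (s.ι ⊕ Fin d.r) s.ι ℝ) =
      s.V := by
    simp [Matrix.fromCols_mul_fromRows]
  exact h

theorem VState.L_next_mul_incl (s : VState n m) (d : VStep n m) :
    (s.next d).L * s.incl d = s.L := by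
  have h : Matrix.fromCols s.L d.L * (Matrix.fromRows 1 0 : Matrix (s.ι ⊕ Fin d.r) s.ι ℝ) =
      s.L := by
    simp [Matrix.fromCols_mul_fromRows]
  exact h

theorem VState.exp_next_mul_incl (s : VState n m) (d : VStep n m) (t : ℝ) :
    exp (t • -(s.next d).S) * s.incl d = s.incl d * exp (t • -s.S) :=
  exp_mul_of_intertwine (by rw [Matrix.neg_mul, s.S_next_mul_incl d, Matrix.mul_neg]) t

/-- A projection of a positive definite matrix. -/
theorem posSemidef_inv_sub {ι κ : Type} [Fintype ι] [Fintype κ] [DecidableEq ι] [DecidableEq κ]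
    {M : Matrix ι ι ℝ} (hM : M.PosDef) (E : Matrix ι κ ℝ) (hE : IsUnit (Eᵀ * M * E).det) :
    (M⁻¹ - E * (Eᵀ * M * E)⁻¹ * Eᵀ).PosSemidef := by
  set Z := M⁻¹ - E * (Eᵀ * M * E)⁻¹ * Eᵀ with hZ
  have hMu := isUnit_det_of_posDef hM
  have hsym : Mᵀ = M := by simpa using hM.isHermitian.eq
  have hZt : Zᵀ = Z := by
    simp [hZ, Matrix.transpose_nonsing_inv, hsym, Matrix.mul_assoc]
  have hZE : Z * M * E = 0 := by
    rw [hZ, Matrix.sub_mul, Matrix.sub_mul, Matrix.nonsing_inv_mul _ hMu, Matrix.one_mul]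
    rw [show E * (Eᵀ * M * E)⁻¹ * Eᵀ * M * E = E * ((Eᵀ * M * E)⁻¹ * (Eᵀ * M * E)) by
      simp only [Matrix.mul_assoc], Matrix.nonsing_inv_mul _ hE, Matrix.mul_one, sub_self]
  -- Since `Z M E = 0`, only the term `M⁻¹` of the last factor contributes; `Z` is thus a congruence
  -- of `M`.
  have hmain : Z * M * Zᵀ = Z := by
    rw [hZt]
    nth_rewrite 2 [hZ]
    rw [Matrix.mul_sub, Matrix.mul_nonsing_inv_cancel_right _ _ hMu, ← Matrix.mul_assoc,
      ← Matrix.mul_assoc, hZE, Matrix.zero_mul, Matrix.zero_mul, sub_zero]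
  have h := hM.posSemidef.mul_mul_conjTranspose_same Z
  rwa [Matrix.conjTranspose_eq_transpose_of_trivial, hmain] at h

/-! ### Comparison of consecutive V-type models. -/

section Step

variable {d : VStep n m}

theorem VState.Vt_next_mul (s : VState n m) (d : VStep n m) (A : Matrix (Fin n) (Fin n) ℝ) (t : ℝ) :
    (s.next d).Vt A t * s.incl d = s.Vt A t := by
  rw [VState.Vt, VState.Vt, Matrix.sub_mul, s.V_next_mul_incl, Matrix.mul_assoc _ (exp _) _,
    s.exp_next_mul_incl, ← Matrix.mul_assoc, Matrix.mul_assoc _ (s.next d).V, s.V_next_mul_incl]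

/-- The old factor `L exp(-S τ)` is the new one times `incl`. The output matrices play no role, so
`G` and `G'` are arbitrary. -/
theorem VState.mixedCtrlGram_next_rom (s : VState n m) (d : VStep n m)
    (G G' : StateSpace (Fin n) m p) (t : ℝ) {ι : Type} [Fintype ι] [DecidableEq ι]
    (R : StateSpace ι m p) :
    mixedCtrlGram t R (s.rom G t) = mixedCtrlGram t R ((s.next d).rom G' t) *
      s.incl d := by
  have hc : Continuous fun τ : ℝ => exp (τ • R.A) * R.B * ((s.next d).rom G' t).Bᵀ *
      exp (τ • ((s.next d).rom G' t).Aᵀ) :=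
    (((continuous_exp_smul _).matrix_mul continuous_const).matrix_mul
      continuous_const).matrix_mul (continuous_exp_smul _)
  refine Eq.trans ?_ (matIntegral_mul_right _ t hc)
  rw [mixedCtrlGram]
  congr 1
  funext τ
  simp only [VState.rom, Matrix.transpose_transpose]
  rw [Matrix.mul_assoc _ (exp (τ • -(s.next d).S)), s.exp_next_mul_incl,
    Matrix.mul_assoc _ (-(s.next d).L),
    ← Matrix.mul_assoc (-(s.next d).L), Matrix.neg_mul, s.L_next_mul_incl, Matrix.mul_assoc _ (-s.L)]

theorem VState.IsCumulative.PtInv_eq {A : Matrix (Fin n) (Fin n) ℝ} {B : Matrix (Fin n) (Fin m) ℝ}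
    (hs : s.IsCumulative A B) (hs' : (s.next d).IsCumulative A B) (t : ℝ) :
    (s.incl d)ᵀ * (s.next d).PtInv t *
      s.incl d = s.PtInv t := by
  let G : StateSpace (Fin n) m 0 := ⟨A, B, 0⟩
  rw [← VState.IsCumulative.ctrlGram_rom (G := G) hs t,
    ← VState.IsCumulative.ctrlGram_rom (G := G) hs' t, ctrlGram, ctrlGram,
    VState.mixedCtrlGram_next_rom s d G G t (s.rom G t),
    ← mixedCtrlGram_transpose t ((s.next d).rom G t) (s.rom G t),
    VState.mixedCtrlGram_next_rom s d G G t ((s.next d).rom G t), Matrix.transpose_mul,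
    mixedCtrlGram_transpose]

/-- Both models are optimal for `G`: restricting the new condition along `incl` turns its left side
into the mixed Gramian term of the two models and its right side into that of the old condition. -/
theorem VState.IsCumulative.ctrlOptimality_next (hs : s.IsCumulative G.A G.B)
    (hs' : (s.next d).IsCumulative G.A G.B) {t : ℝ} (ht : 0 < t) :
    CtrlOptimality t ((s.next d).rom G t) (s.rom G t) := by
  rw [CtrlOptimality, hs.ctrlOptimality ht, s.mixedCtrlGram_next_rom d G G t G,
    s.mixedCtrlGram_next_rom d G G t ((s.next d).rom G t), ← Matrix.mul_assoc, ← Matrix.mul_assoc,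
    ← hs'.ctrlOptimality ht, ctrlGram]

/-- The difference is the congruence by the new `V_t` of the matrix in `posSemidef_inv_sub`, with
`M` the new `PtInv` and `E` the inclusion. -/
theorem VState.IsCumulative.posSemidef_approxGram_sub {A : Matrix (Fin n) (Fin n) ℝ}
    {B : Matrix (Fin n) (Fin m) ℝ} (hs : s.IsCumulative A B)
    (hs' : (s.next d).IsCumulative A B) {t : ℝ} (ht : 0 < t) :
    ((s.next d).approxGram A t - s.approxGram A t).PosSemidef := by
  have hE := hs.PtInv_eq hs' t
  have hZ := posSemidef_inv_sub (hs'.PtInv_posDef ht)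
    (s.incl d) (hE ▸ hs.isUnit_det_PtInv ht)
  rw [hE] at hZ
  have h := hZ.mul_mul_conjTranspose_same ((s.next d).Vt A t)
  rw [Matrix.conjTranspose_eq_transpose_of_trivial, Matrix.mul_sub, Matrix.sub_mul] at h
  have e : s.approxGram A t = (s.next d).Vt A t *
      (s.incl d * (s.PtInv t)⁻¹ * (s.incl d)ᵀ) * ((s.next d).Vt A t)ᵀ := by
    rw [VState.approxGram, ← s.Vt_next_mul d A t, Matrix.transpose_mul, VState.Pt]
    simp only [Matrix.mul_assoc]
  rw [e]
  exact h

theorem VState.IsCumulative.errNorm2t_next_le (hs : s.IsCumulative G.A G.B)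
    (hs' : (s.next d).IsCumulative G.A G.B) {t : ℝ} (ht : 0 < t) :
    errNorm2t t G ((s.next d).rom G t) ≤ errNorm2t t G (s.rom G t) := by
  refine le_of_sq_le_sq ?_ (Real.sqrt_nonneg _)
  rw [hs.errNorm2t_sq ht, hs'.errNorm2t_sq ht, ← sub_nonneg, ← Matrix.trace_sub, ← Matrix.sub_mul,
    ← Matrix.mul_sub, sub_sub_sub_cancel_left, ← Matrix.conjTranspose_eq_transpose_of_trivial]
  exact ((hs.posSemidef_approxGram_sub hs' ht).mul_mul_conjTranspose_same G.C).trace_nonneg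

end Step

end VType

/-! ### The W-type reduction by duality. -/

section WType

variable {n m p : ℕ}

/-- The transposed system. -/
def StateSpace.dual {ι : Type} (G : StateSpace ι m p) : StateSpace ι p m where
  A := G.Aᵀ
  B := G.Cᵀ
  C := G.Bᵀ

/-- One step of the W-type reduction of `(A, C)` as a step of the V-type reduction of
`(Aᵀ, Cᵀ)`. -/
def WStep.dual (d : WStep n p) : VStep n p where
  r := d.r
  σ := d.σ
  c := d.bᵀ
  V := d.W
  S := d.Sᵀ
  L := d.Lᵀ
  -- With `Pᵀ` in place of `P`, duality is pure transposition and needs no symmetry of `P`.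
  Q := d.Pᵀ

/-- The matrices of the W-type reduction of `(A, C)` as those of the V-type reduction of
`(Aᵀ, Cᵀ)`. -/
def WState.dual (s : WState n p) : VState n p where
  ι := s.ι
  S := s.Sᵀ
  L := s.Lᵀ
  V := s.W
  P := s.Qᵀ
  Bbar := s.Cbarᵀ
  Bperp := s.Cperpᵀ

theorem WStep.IsPORK.dual {d : WStep n p} {A : Matrix (Fin n) (Fin n) ℝ}
    {C : Matrix (Fin p) (Fin n) ℝ} (h : d.IsPORK A C) : d.dual.IsPORK Aᵀ Cᵀ where
  re_pos := h.re_pos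
  resolvent j := by
    have e : toC Aᵀ - d.σ j • 1 = (toC A - d.σ j • 1)ᵀ := by
      rw [Matrix.transpose_sub, Matrix.transpose_smul, Matrix.transpose_one]
      rfl
    change IsUnit (toC Aᵀ - d.σ j • 1).det
    rw [e, Matrix.det_transpose]
    exact h.resolvent j
  krylov := h.krylov
  observable := fun (x : Fin d.r → ℝ) hx => h.controllable x fun q => by
    rw [← Matrix.mulVec_transpose, Matrix.transpose_mul, Matrix.transpose_pow]
    exact hx q
  lyapunov := by
    have e := congrArg Matrix.transpose h.lyapunov
    change -(d.Sᵀᵀ * d.Pᵀ) - d.Pᵀ * d.Sᵀ + d.Lᵀᵀ * d.Lᵀ = 0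
    simp only [Matrix.transpose_add, Matrix.transpose_sub, Matrix.transpose_neg,
      Matrix.transpose_mul, Matrix.transpose_transpose, Matrix.transpose_zero] at e ⊢
    rw [← e]
    abel

theorem WState.dual_next (s : WState n p) (d : WStep n p) :
    (s.next d).dual = s.dual.next d.dual := by
  have hS : (Matrix.fromBlocks s.S 0 (-(d.L * s.Cbar)) d.S)ᵀ =
      Matrix.fromBlocks s.Sᵀ (-(s.Cbarᵀ * d.Lᵀ)) 0 d.Sᵀ := by
    simp [Matrix.fromBlocks_transpose]
  have hQ : (Matrix.fromBlocks s.Q 0 0 d.P⁻¹)ᵀ = Matrix.fromBlocks s.Qᵀ 0 0 (d.Pᵀ)⁻¹ := by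
    simp [Matrix.fromBlocks_transpose, Matrix.transpose_nonsing_inv]
  have hC : d.Chatᵀ = -((d.Pᵀ)⁻¹ * d.Lᵀᵀ) := by
    simp [WStep.Chat, Matrix.transpose_nonsing_inv]
  have hCbar : (Matrix.fromCols s.Cbar d.Chat)ᵀ =
      Matrix.fromRows s.Cbarᵀ (-((d.Pᵀ)⁻¹ * d.Lᵀᵀ)) := by
    rw [Matrix.transpose_fromCols, hC]
  have hCperp : (s.Cperp - d.Chat * d.Wᵀ)ᵀ = s.Cperpᵀ - d.W * (-((d.Pᵀ)⁻¹ * d.Lᵀᵀ)) := by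
    rw [Matrix.transpose_sub, Matrix.transpose_mul, hC, Matrix.transpose_transpose]
  have hL : (Matrix.fromRows s.L d.L)ᵀ = Matrix.fromCols s.Lᵀ d.Lᵀ := Matrix.transpose_fromRows _ _
  change VState.mk _ (Matrix.fromBlocks s.S 0 (-(d.L * s.Cbar)) d.S)ᵀ (Matrix.fromRows s.L d.L)ᵀ _
    (Matrix.fromBlocks s.Q 0 0 d.P⁻¹)ᵀ (Matrix.fromCols s.Cbar d.Chat)ᵀ
    (s.Cperp - d.Chat * d.Wᵀ)ᵀ = _
  rw [hS, hQ, hCbar, hCperp, hL]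
  rfl

theorem dual_wState (C : Matrix (Fin p) (Fin n) ℝ) (d : ℕ → WStep n p) :
    ∀ i, (wState C d i).dual = vState Cᵀ (fun i => (d i).dual) i
  | 0 => rfl
  | i + 1 => by
    change ((wState C d i).next (d i)).dual = (vState Cᵀ (fun i => (d i).dual) i).next (d i).dual
    rw [WState.dual_next, dual_wState C d i]

theorem WState.dual_Vt (s : WState n p) (A : Matrix (Fin n) (Fin n) ℝ) (t : ℝ) :
    s.dual.Vt Aᵀ t = s.Wt A t := by
  rfl

theorem WState.dual_PtInv (s : WState n p) (t : ℝ) : s.dual.PtInv t = (s.QtInv t)ᵀ := by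
  change (s.Qᵀ)⁻¹ - exp (t • (-s.Sᵀ)ᵀ) * (s.Qᵀ)⁻¹ * exp (t • -s.Sᵀ) = _
  rw [WState.QtInv]
  simp only [Matrix.transpose_sub, Matrix.transpose_mul, ← Matrix.transpose_neg,
    exp_smul_transpose, Matrix.transpose_transpose, Matrix.transpose_nonsing_inv, Matrix.mul_assoc]

theorem WState.dual_Pt (s : WState n p) (t : ℝ) : s.dual.Pt t = (s.Qt t)ᵀ := by
  rw [VState.Pt, WState.dual_PtInv, WState.Qt, Matrix.transpose_nonsing_inv]
  rfl

theorem WState.dual_approxGram (s : WState n p) (A : Matrix (Fin n) (Fin n) ℝ) (t : ℝ) :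
    s.dual.approxGram Aᵀ t = (s.approxGram A t)ᵀ := by
  rw [VState.approxGram, WState.dual_Vt, WState.dual_Pt, WState.approxGram, Matrix.transpose_mul,
    Matrix.transpose_mul, Matrix.transpose_transpose]
  exact Matrix.mul_assoc _ _ _

theorem WState.dual_rom (s : WState n p) (G : StateSpace (Fin n) m p) (t : ℝ) :
    (s.rom G t).dual = s.dual.rom G.dual t := by
  have hA : (-s.S)ᵀᵀ = (-s.Sᵀ)ᵀ := by simp
  have hB : (-s.L)ᵀᵀ = (-s.Lᵀ)ᵀ := by simp
  have hC : (s.Qt t * (s.Wt G.A t)ᵀ * G.B)ᵀ = G.Bᵀ * s.dual.Vt G.Aᵀ t * s.dual.Pt t := by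
    rw [WState.dual_Vt, WState.dual_Pt, Matrix.transpose_mul, Matrix.transpose_mul,
      Matrix.transpose_transpose]
    exact (Matrix.mul_assoc _ _ _).symm
  change StateSpace.mk (-s.S)ᵀᵀ (-s.L)ᵀᵀ (s.Qt t * (s.Wt G.A t)ᵀ * G.B)ᵀ = _
  rw [hA, hB, hC]
  rfl

section Dual

variable {ι κ : Type} [Fintype ι] [DecidableEq ι] [Fintype κ] [DecidableEq κ]

theorem StateSpace.dual_impulse (G : StateSpace ι m p) (τ : ℝ) :
    G.dual.impulse τ = (G.impulse τ)ᵀ := by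
  simp [StateSpace.impulse, StateSpace.dual, exp_smul_transpose, Matrix.mul_assoc]

theorem h2tNorm_transpose (t : ℝ) {h : ℝ → Matrix (Fin p) (Fin m) ℝ} (hc : Continuous h) :
    h2tNorm t (fun τ => (h τ)ᵀ) = h2tNorm t h := by
  rw [h2tNorm, h2tNorm, trace_matIntegral _ (hc.matrix_mul hc.matrix_transpose),
    trace_matIntegral _ (hc.matrix_transpose.matrix_mul hc.matrix_transpose.matrix_transpose)]
  simp only [Matrix.transpose_transpose]
  congr 1
  exact intervalIntegral.integral_congr fun τ _ => Matrix.trace_mul_comm _ _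

theorem dual_norm2t (t : ℝ) (G : StateSpace ι m p) : G.dual.norm2t t = G.norm2t t := by
  rw [StateSpace.norm2t, funext G.dual_impulse, h2tNorm_transpose t G.continuous_impulse,
    StateSpace.norm2t]

theorem dual_errNorm2t (t : ℝ) (G : StateSpace ι m p) (R : StateSpace κ m p) :
    errNorm2t t G.dual R.dual = errNorm2t t G R := by
  simp only [errNorm2t, StateSpace.dual_impulse, ← Matrix.transpose_sub]
  exact h2tNorm_transpose t (G.continuous_impulse.sub R.continuous_impulse)

theorem dual_isPseudoOptimal {t : ℝ} {G : StateSpace ι m p} {R : StateSpace κ m p} :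
    IsPseudoOptimal t G.dual R.dual ↔ IsPseudoOptimal t G R := by
  rw [IsPseudoOptimal, dual_errNorm2t, dual_norm2t, dual_norm2t, IsPseudoOptimal]

/-- Controllability Gramians of dual systems unfold to observability Gramians; transposing restores
the order of the factors. -/
theorem CtrlOptimality.of_dual {t : ℝ} {G : StateSpace ι m p} {R : StateSpace κ m p}
    (h : CtrlOptimality t G.dual R.dual) : ObsOptimality t G R := by
  rw [CtrlOptimality, ← Matrix.transpose_inj, Matrix.transpose_mul, Matrix.transpose_mul, ctrlGram,
    mixedCtrlGram_transpose, mixedCtrlGram_transpose] at h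
  exact h

end Dual

end WType

end TimeLimited

theorem mainTheorem3 {n m p : ℕ} (G : TimeLimited.StateSpace (Fin n) m p) (t : ℝ) (ht : 0 < t)
    (k : ℕ) :
    -- V-type
    (∀ d : ℕ → TimeLimited.VStep n m,
      (∀ i < k, (d i).IsPORK G.A (TimeLimited.vState G.B d i).Bperp) →
      (∀ i ≤ k, ∀ s, s = TimeLimited.vState G.B d i →
        IsUnit s.P.det ∧ IsUnit (s.PtInv t).det ∧
        TimeLimited.IsPseudoOptimal t G (s.rom G t) ∧
        TimeLimited.CtrlOptimality t G (s.rom G t) ∧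
        (TimeLimited.ctrlGram t G - s.approxGram G.A t).PosSemidef ∧
        TimeLimited.errNorm2t t G (s.rom G t) ^ 2 =
          (G.C * (TimeLimited.ctrlGram t G - s.approxGram G.A t) * G.Cᵀ).trace) ∧
      (∀ i < k, ∀ s s', s = TimeLimited.vState G.B d i → s' = TimeLimited.vState G.B d (i + 1) →
        TimeLimited.IsPseudoOptimal t (s'.rom G t) (s.rom G t) ∧
        TimeLimited.CtrlOptimality t (s'.rom G t) (s.rom G t) ∧
        TimeLimited.errNorm2t t G (s'.rom G t) ≤ TimeLimited.errNorm2t t G (s.rom G t) ∧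
        (s'.approxGram G.A t - s.approxGram G.A t).PosSemidef)) ∧
    -- W-type
    (∀ d : ℕ → TimeLimited.WStep n p,
      (∀ i < k, (d i).IsPORK G.A (TimeLimited.wState G.C d i).Cperp) →
      (∀ i ≤ k, ∀ s, s = TimeLimited.wState G.C d i →
        IsUnit s.Q.det ∧ IsUnit (s.QtInv t).det ∧
        TimeLimited.IsPseudoOptimal t G (s.rom G t) ∧
        TimeLimited.ObsOptimality t G (s.rom G t) ∧
        (TimeLimited.obsGram t G - s.approxGram G.A t).PosSemidef ∧
        TimeLimited.errNorm2t t G (s.rom G t) ^ 2 =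
          (G.Bᵀ * (TimeLimited.obsGram t G - s.approxGram G.A t) * G.B).trace) ∧
      (∀ i < k, ∀ s s', s = TimeLimited.wState G.C d i → s' = TimeLimited.wState G.C d (i + 1) →
        TimeLimited.IsPseudoOptimal t (s'.rom G t) (s.rom G t) ∧
        TimeLimited.ObsOptimality t (s'.rom G t) (s.rom G t) ∧
        TimeLimited.errNorm2t t G (s'.rom G t) ≤ TimeLimited.errNorm2t t G (s.rom G t) ∧
        (s'.approxGram G.A t - s.approxGram G.A t).PosSemidef)) := by
  constructor
  · intro d hd
    have hcum := TimeLimited.isCumulative_vState hd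
    refine ⟨?_, ?_⟩
    · rintro i hi s rfl
      have hs := hcum i hi
      exact ⟨TimeLimited.isUnit_det_of_posDef hs.posDef, hs.isUnit_det_PtInv ht,
        (hs.ctrlOptimality ht).isPseudoOptimal ht.le, hs.ctrlOptimality ht,
        hs.posSemidef_ctrlGram_sub ht, hs.errNorm2t_sq ht⟩
    · rintro i hi s s' rfl rfl
      have hs := hcum i hi.le
      have hs' := hcum (i + 1) hi
      exact ⟨(hs.ctrlOptimality_next hs' ht).isPseudoOptimal ht.le, hs.ctrlOptimality_next hs' ht,
        hs.errNorm2t_next_le hs' ht, hs.posSemidef_approxGram_sub hs' ht⟩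
  · intro d hd
    have hdual := TimeLimited.dual_wState G.C d
    have hcum : ∀ i ≤ k, (TimeLimited.wState G.C d i).dual.IsCumulative G.Aᵀ G.Cᵀ := by
      intro i hi
      rw [hdual]
      refine TimeLimited.isCumulative_vState (fun j hj => ?_) i hi
      rw [← hdual]
      exact (hd j hj).dual
    refine ⟨?_, ?_⟩
    · rintro i hi s rfl
      set s := TimeLimited.wState G.C d i
      have hs : s.dual.IsCumulative G.dual.A G.dual.B := hcum i hi
      have hopt := hs.ctrlOptimality ht
      have hpsd := hs.posSemidef_ctrlGram_sub ht
      have herr := hs.errNorm2t_sq ht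
      -- Duality gives the transpose, which symmetry of the V-type approximation removes.
      have happ : s.dual.approxGram G.dual.A t = s.approxGram G.A t := by
        rw [← hs.approxGram_transpose ht]
        exact (congrArg Matrix.transpose (s.dual_approxGram G.A t)).trans
          (Matrix.transpose_transpose _)
      rw [happ] at hpsd herr
      rw [← s.dual_rom] at hopt herr
      replace hopt : TimeLimited.CtrlOptimality t G.dual (s.rom G t).dual := hopt
      replace herr := (congrArg (· ^ 2) (TimeLimited.dual_errNorm2t t G (s.rom G t))).symm.trans herr
      refine ⟨?_, ?_, TimeLimited.dual_isPseudoOptimal.1 (hopt.isPseudoOptimal ht.le),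
        hopt.of_dual, hpsd, herr⟩
      · rw [← Matrix.det_transpose]
        exact TimeLimited.isUnit_det_of_posDef hs.posDef
      · have h := hs.isUnit_det_PtInv ht
        rw [s.dual_PtInv] at h
        rw [← Matrix.det_transpose]
        exact h
    · rintro i hi s s' rfl rfl
      have hs : (TimeLimited.wState G.C d i).dual.IsCumulative G.dual.A G.dual.B := hcum i hi.le
      have hs' := hcum (i + 1) hi
      change ((TimeLimited.wState G.C d i).next (d i)).dual.IsCumulative G.dual.A G.dual.B at hs'
      change TimeLimited.IsPseudoOptimal t (((TimeLimited.wState G.C d i).next (d i)).rom G t) _ ∧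
        TimeLimited.ObsOptimality t (((TimeLimited.wState G.C d i).next (d i)).rom G t) _ ∧
        TimeLimited.errNorm2t t G (((TimeLimited.wState G.C d i).next (d i)).rom G t) ≤ _ ∧
        (((TimeLimited.wState G.C d i).next (d i)).approxGram G.A t - _).PosSemidef
      set s := TimeLimited.wState G.C d i
      -- The dual of the next state equals the next dual state only propositionally, and the types
      -- of the models depend on the state; a variable `u` allows substitution.
      have key : ∀ u, u = s.dual.next (d i).dual → u.IsCumulative G.dual.A G.dual.B →
          TimeLimited.CtrlOptimality t (u.rom G.dual t) (s.dual.rom G.dual t) ∧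
          TimeLimited.errNorm2t t G.dual (u.rom G.dual t) ≤
            TimeLimited.errNorm2t t G.dual (s.dual.rom G.dual t) ∧
          (u.approxGram G.dual.A t - s.dual.approxGram G.dual.A t).PosSemidef := by
        rintro u rfl hu
        exact ⟨hs.ctrlOptimality_next hu ht, hs.errNorm2t_next_le hu ht,
          hs.posSemidef_approxGram_sub hu ht⟩
      obtain ⟨hopt, herr, hpsd⟩ := key _ (s.dual_next (d i)) hs'
      rw [← s.dual_rom, ← (s.next (d i)).dual_rom] at hopt herr
      replace hopt : TimeLimited.CtrlOptimality t ((s.next (d i)).rom G t).dual (s.rom G t).dual :=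
        hopt
      refine ⟨TimeLimited.dual_isPseudoOptimal.1 (hopt.isPseudoOptimal ht.le), hopt.of_dual, ?_, ?_⟩
      · exact ((TimeLimited.dual_errNorm2t t G ((s.next (d i)).rom G t)).symm.trans_le herr).trans_eq
          (TimeLimited.dual_errNorm2t t G (s.rom G t))
      · rw [← Matrix.posSemidef_transpose_iff, Matrix.transpose_sub]
        refine Eq.subst (motive := Matrix.PosSemidef) ?_ hpsd
        exact congrArg₂ (· - ·) ((s.next (d i)).dual_approxGram G.A t) (s.dual_approxGram G.A t)
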